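/- Let $n\ge 1$. An almost paracontact paracomplex Riemannian (apcpcR) manifold $(M^{2n+1},\phi,\xi,\eta,g)$ is a smooth Riemannian manifold $(M,g)$ of dimension $2n+1$ (Hausdorff, second countable) with a smooth $(1,1)$-tensor field $\phi$, a smooth vector field $\xi$ and a smooth $1$-form $\eta$ such that $$\phi^2=\mathrm{id}-\eta\otimes\xi,\quad \eta(\xi)=1,\quad g(x,\xi)=\eta(x),\quad g(\phi x,\phi y)=g(x,y)-\eta(x)\eta(y),$$ and such that the eigenspaces of $\phi$ for the eigenvalues $+1$ and $-1$ both have dimension $n$ at every point. Let $\nabla$ be the Levi-Civita connection of $g$, $F(x,y,z)=g((\nabla_x\phi)y,z)$ and $H=\ker\eta$. The manifold is called para-Sasaki-like if for all $X,Y,Z\in H$ $$F(X,Y,Z)=F(\xi,Y,Z)=F(\xi,\xi,Z)=0,\qquad F(X,Y,\xi)=-g(X,Y).$$ An integral manifold of $H$ is a smooth (Hausdorff, second countable) $2n$-dimensional manifold $N$ with an injective smooth immersion $\iota:N\to M$ such that $\mathrm d\iota(T_pN)=H_{\iota(p)}$ for all $p\in N$. It carries the metric $h=\iota^*g$ and the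 endomorphism field $P$ with $\mathrm d\iota\circ P=\phi\circ \mathrm d\iota$, that is, $h=g|_H$ and $P=\phi|_H$. A triple $(N^{2n},P,h)$ of a smooth $2n$-manifold, a smooth $(1,1)$-tensor field and a Riemannian metric is called a phpcR (paraholomorphic paracomplex Riemannian) manifold if $P^2=\mathrm{id}$, the eigenspaces of $P$ for $+1$ and $-1$ both have dimension $n$, $h(PX,PY)=h(X,Y)$, and $\nabla^hP=0$ for the Levi-Civita connection $\nabla^h$ of $h$. With $R(x,y)z=\nabla_x\nabla_yz-\nabla_y\nabla_xz-\nabla_{[x,y]}z$, the Ricci tensor is $Ric(y,z)=\sum_i g(R(e_i,y)z,e_i)$ and the scalar curvature is $Scal=\sum_i Ric(e_i,e_i)$, for an orthonormal basis $(e_i)$ of the tangent space; a Riemannian manifold is Einstein if $Ric=c\,g$ for some constant $c$. **Proposition 3.2.** Let $(M,\phi,\xi,\eta,g)$ be a para-Sasaki-like Riemannian manifold of dimension $2n+1$. Through every point of $M$ there passes an integral manifold of $H$, and every integral manifold $(N^{2n},P,h)$ of $H$ is a phpcR manifold (these are the underlying local phpcR manifolds of $M$). The manifold $(M,g)$ is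 Einstein if and only if the underlying local phpcR manifolds satisfy $$Ric^h=-2n\,h;$$ here it is the same to require this of all integral manifolds of $H$, or of at least one integral manifold through each point of $M$. For each integral manifold $(N^{2n},P,h)$, the condition $Ric^h=-2n\,h$ holds if and only if $(N,h)$ is Einstein and its scalar curvature is $-4n^2$ everywhere. -/

import Mathlib

open Bundle Manifold
open scoped ContDiff

universe u

namespace ParaSasaki

/-! ### Levi-Civita connection, curvature, Ricci tensor of a Riemannian manifold `(M, g)`

The metric `g` is given by the inner product `inner ℝ` on the tangent spaces. -/

section RiemannianGeometry

variable {E : Type*} [NormedAddCommGroup E] [NormedSpace ℝ E] [FiniteDimensional ℝ E]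
  {H : Type*} [TopologicalSpace H] {I : ModelWithCorners ℝ E H}
  {M : Type*} [TopologicalSpace M] [ChartedSpace H M]
  [RiemannianBundle (fun x : M ↦ TangentSpace I x)]

/-- The right-hand side of the Koszul formula `2 g(∇_X Y, Z) = ...` at the point `p`. -/
noncomputable def koszul (X Y Z : Π x : M, TangentSpace I x) (p : M) : ℝ :=
  mvfderiv I (fun q ↦ inner ℝ (Y q) (Z q)) p (X p)
    + mvfderiv I (fun q ↦ inner ℝ (Z q) (X q)) p (Y p)
    - mvfderiv I (fun q ↦ inner ℝ (X q) (Y q)) p (Z p)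
    + inner ℝ (VectorField.mlieBracket I X Y p) (Z p)
    + inner ℝ (VectorField.mlieBracket I Z X p) (Y p)
    + inner ℝ (VectorField.mlieBracket I Z Y p) (X p)

variable [IsManifold I ∞ M] [IsContMDiffRiemannianBundle I ∞ E (fun x : M ↦ TangentSpace I x)]

theorem mdiff_inner {X Y : Π x : M, TangentSpace I x} {p : M}
    (hX : MDiffAt (T% X) p) (hY : MDiffAt (T% Y) p) :
    MDiffAt (fun q ↦ (inner ℝ (X q) (Y q) : ℝ)) p :=
  MDifferentiableAt.inner_bundle (E := fun x : M ↦ TangentSpace I x) (F := E)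
    (v := X) (w := Y) hX hY

theorem koszul_tensorial_right {X Y : Π x : M, TangentSpace I x} {p : M}
    (hX : MDiffAt (T% X) p) (hY : MDiffAt (T% Y) p) :
    TensorialAt I E (fun Z ↦ koszul X Y Z p) p where
  smul {f Z} hf hZ := by
    have : CompleteSpace E := FiniteDimensional.complete ℝ E
    have h1 := mdiff_inner hY hZ
    have h2 := mdiff_inner hZ hX
    simp only [koszul, Pi.smul_apply', inner_smul_left, inner_smul_right, RCLike.conj_to_real,
      mvfderiv_fun_mul hf h1, mvfderiv_fun_mul hf h2, VectorField.mlieBracket_smul_left hf hZ,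
      inner_add_left, map_smul]
    simp
    rw [real_inner_comm (Y p) (Z p)]
    ring
  add {Z Z'} hZ hZ' := by
    have : CompleteSpace E := FiniteDimensional.complete ℝ E
    simp only [koszul, Pi.add_apply, inner_add_left, inner_add_right,
      mvfderiv_fun_add (mdiff_inner hY hZ) (mdiff_inner hY hZ'),
      mvfderiv_fun_add (mdiff_inner hZ hX) (mdiff_inner hZ' hX),
      VectorField.mlieBracket_add_left hZ hZ', map_add]
    simp
    ring

theorem koszul_tensorial_left {Y Z : Π x : M, TangentSpace I x} {p : M}
    (hY : MDiffAt (T% Y) p) (hZ : MDiffAt (T% Z) p) :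
    TensorialAt I E (fun X ↦ koszul X Y Z p) p where
  smul {f X} hf hX := by
    have : CompleteSpace E := FiniteDimensional.complete ℝ E
    have h1 := mdiff_inner hX hY
    have h2 := mdiff_inner hZ hX
    simp only [koszul, Pi.smul_apply', inner_smul_left, inner_smul_right, RCLike.conj_to_real,
      mvfderiv_fun_mul hf h1, mvfderiv_fun_mul hf h2, VectorField.mlieBracket_smul_left hf hX,
      VectorField.mlieBracket_smul_right hf hX,
      inner_add_left, map_smul]
    simp
    rw [real_inner_comm (X p) (Z p)]
    ring
  add {X X'} hX hX' := by
    have : CompleteSpace E := FiniteDimensional.complete ℝ E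
    simp only [koszul, Pi.add_apply, inner_add_left, inner_add_right,
      mvfderiv_fun_add (mdiff_inner hX hY) (mdiff_inner hX' hY),
      mvfderiv_fun_add (mdiff_inner hZ hX) (mdiff_inner hZ hX'),
      VectorField.mlieBracket_add_left hX hX', VectorField.mlieBracket_add_right hX hX', map_add]
    simp
    ring

theorem koszul_add_mid {X Y Y' Z : Π x : M, TangentSpace I x} {p : M}
    (hX : MDiffAt (T% X) p) (hY : MDiffAt (T% Y) p) (hY' : MDiffAt (T% Y') p)
    (hZ : MDiffAt (T% Z) p) :
    koszul X (Y + Y') Z p = koszul X Y Z p + koszul X Y' Z p := by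
  have : CompleteSpace E := FiniteDimensional.complete ℝ E
  simp only [koszul, Pi.add_apply, inner_add_left, inner_add_right,
    mvfderiv_fun_add (mdiff_inner hX hY) (mdiff_inner hX hY'),
    mvfderiv_fun_add (mdiff_inner hY hZ) (mdiff_inner hY' hZ),
    VectorField.mlieBracket_add_right hY hY', map_add]
  simp
  ring

theorem koszul_smul_mid {X Y Z : Π x : M, TangentSpace I x} {f : M → ℝ} {p : M}
    (hf : MDiffAt f p) (hX : MDiffAt (T% X) p) (hY : MDiffAt (T% Y) p) (hZ : MDiffAt (T% Z) p) :
    koszul X (f • Y) Z p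
      = f p * koszul X Y Z p + 2 * (mvfderiv I f p (X p) * inner ℝ (Y p) (Z p)) := by
  have : CompleteSpace E := FiniteDimensional.complete ℝ E
  simp only [koszul, Pi.smul_apply', inner_smul_left, inner_smul_right, RCLike.conj_to_real,
    mvfderiv_fun_mul hf (mdiff_inner hX hY), mvfderiv_fun_mul hf (mdiff_inner hY hZ),
    VectorField.mlieBracket_smul_right hf hY, inner_add_left, map_smul]
  simp
  rw [real_inner_comm (X p) (Y p)]
  ring


instance tangentSpace_finiteDimensional (p : M) : FiniteDimensional ℝ (TangentSpace I p) :=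
  inferInstanceAs (FiniteDimensional ℝ E)

theorem exists_koszul_vector {Y : Π x : M, TangentSpace I x} {p : M} (hY : MDiffAt (T% Y) p) :
    ∃ A : TangentSpace I p →L[ℝ] TangentSpace I p, ∀ X Z : Π x : M, TangentSpace I x,
      MDiffAt (T% X) p → MDiffAt (T% Z) p → 2 * inner ℝ (A (X p)) (Z p) = koszul X Y Z p := by
  let B := TensorialAt.mkHom₂ (I := I) (F := E) (F' := E) (fun X Z ↦ koszul X Y Z p) p
    (fun Z hZ ↦ koszul_tensorial_left hY hZ) (fun X hX ↦ koszul_tensorial_right hX hY)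
  have : CompleteSpace (TangentSpace I p) := FiniteDimensional.complete ℝ _
  let A : TangentSpace I p →ₗ[ℝ] TangentSpace I p :=
    { toFun := fun u ↦ (InnerProductSpace.toDual ℝ (TangentSpace I p)).symm ((1 / 2 : ℝ) • B u)
      map_add' := fun u v ↦ by rw [map_add, smul_add, map_add]
      map_smul' := fun c u ↦ by
        have h : (1 / 2 : ℝ) • B (c • u) = c • ((1 / 2 : ℝ) • B u) := by rw [map_smul B, smul_comm]
        rw [h]
        simp }
  refine ⟨A.toContinuousLinearMap, fun X Z hX hZ ↦ ?_⟩
  have h : B (X p) (Z p) = koszul X Y Z p := TensorialAt.mkHom₂_apply _ _ hX hZ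
  rw [← h]
  change 2 * inner ℝ ((InnerProductSpace.toDual ℝ (TangentSpace I p)).symm
    ((1 / 2 : ℝ) • B (X p))) (Z p) = _
  rw [InnerProductSpace.toDual_symm_apply]
  simp

theorem exists_leviCivita :
    ∃ D : CovariantDerivative I E (fun x : M ↦ TangentSpace I x),
      D.torsion = 0 ∧ D.IsMetricCompatible := by
  classical
  have : CompleteSpace E := FiniteDimensional.complete ℝ E
  choose A hA using fun (Y : Π x : M, TangentSpace I x) (p : M) (h : MDiffAt (T% Y) p) ↦
    exists_koszul_vector h
  let cov : (Π x : M, TangentSpace I x) → Π x : M, TangentSpace I x →L[ℝ] TangentSpace I x :=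
    fun Y p ↦ if h : MDiffAt (T% Y) p then A Y p h else 0
  have key : ∀ (X Y Z : Π x : M, TangentSpace I x) (p : M), MDiffAt (T% X) p → MDiffAt (T% Y) p →
      MDiffAt (T% Z) p → 2 * inner ℝ (cov Y p (X p)) (Z p) = koszul X Y Z p := by
    intro X Y Z p hX hY hZ
    simp only [cov, dif_pos hY]
    exact hA Y p hY X Z hX hZ
  have ext_inner : ∀ (p : M) (u v : TangentSpace I p),
      (∀ Z : Π x : M, TangentSpace I x, MDiffAt (T% Z) p →
        2 * inner ℝ u (Z p) = 2 * inner ℝ v (Z p)) → u = v := by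
    intro p u v h
    refine ext_inner_right ℝ fun w ↦ ?_
    have := h (FiberBundle.extend E w) (FiberBundle.mdifferentiableAt_extend ..)
    rw [FiberBundle.extend_apply_self] at this
    linarith
  have fsymm : ∀ U V : Π x : M, TangentSpace I x,
      (fun q ↦ (inner ℝ (U q) (V q) : ℝ)) = fun q ↦ inner ℝ (V q) (U q) :=
    fun U V ↦ funext fun q ↦ real_inner_comm _ _
  have hcov : IsCovariantDerivativeOn E cov Set.univ :=
    { add := by
        intro Y Y' p hY hY' _
        ext u
        refine ext_inner p _ _ fun Z hZ ↦ ?_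
        have hX : MDiffAt (T% (FiberBundle.extend E u)) p := FiberBundle.mdifferentiableAt_extend ..
        have h1 := key _ _ Z p hX (mdifferentiableAt_add_section hY hY') hZ
        have h2 := key _ _ Z p hX hY hZ
        have h3 := key _ _ Z p hX hY' hZ
        rw [FiberBundle.extend_apply_self] at h1 h2 h3
        rw [h1, koszul_add_mid hX hY hY' hZ, ← h2, ← h3, add_apply,
          inner_add_left]
        ring
      leibniz := by
        intro Y f p hY hf _
        ext u
        refine ext_inner p _ _ fun Z hZ ↦ ?_
        have hX : MDiffAt (T% (FiberBundle.extend E u)) p := FiberBundle.mdifferentiableAt_extend ..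
        have h1 := key _ _ Z p hX (hf.smul_section hY) hZ
        have h2 := key _ _ Z p hX hY hZ
        have h4 := koszul_smul_mid hf hX hY hZ
        rw [FiberBundle.extend_apply_self] at h1 h2 h4
        rw [h1, h4, ← h2, add_apply, smul_apply,
          ContinuousLinearMap.smulRight_apply, inner_add_left, real_inner_smul_left,
          real_inner_smul_left]
        ring }
  refine ⟨⟨cov, hcov⟩, ?_, ?_⟩
  · rw [CovariantDerivative.torsion_eq_zero_iff]
    intro X Y p hX hY
    refine ext_inner p _ _ fun Z hZ ↦ ?_
    have h1 := key X Y Z p hX hY hZ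
    have h2 := key Y X Z p hY hX hZ
    change 2 * inner ℝ (cov Y p (X p) - cov X p (Y p)) (Z p) = _
    rw [inner_sub_left, mul_sub, h1, h2]
    simp only [koszul, VectorField.mlieBracket_swap_apply (V := Y) (W := X), inner_neg_left]
    rw [fsymm X Z, fsymm Z Y, fsymm X Y]
    ring
  · rw [CovariantDerivative.isMetricCompatible_iff]
    intro p X Y Z hX hY hZ
    have h1 := key X Y Z p hX hY hZ
    have h2 := key X Z Y p hX hZ hY
    change _ = inner ℝ (cov Y p (X p)) (Z p) + inner ℝ (Y p) (cov Z p (X p))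
    rw [real_inner_comm _ (Y p)]
    simp only [koszul, VectorField.mlieBracket_swap_apply (V := X) (W := Y),
      VectorField.mlieBracket_swap_apply (V := X) (W := Z),
      VectorField.mlieBracket_swap_apply (V := Y) (W := Z), inner_neg_left] at h1 h2
    rw [fsymm Z Y, fsymm X Z, fsymm Y X] at h2
    linarith

variable (I M) in
/-- The Levi-Civita connection: the torsion-free metric covariant derivative on the tangent bundle
(its values on differentiable vector fields are uniquely determined by the Koszul formula).
`leviCivita I M Y p x` is `∇_x Y` at the point `p`. -/
noncomputable def leviCivita : CovariantDerivative I E (fun x : M ↦ TangentSpace I x) :=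
  exists_leviCivita.choose

theorem leviCivita_torsion {X Y : Π x : M, TangentSpace I x} {p : M}
    (hX : MDiffAt (T% X) p) (hY : MDiffAt (T% Y) p) :
    leviCivita I M Y p (X p) - leviCivita I M X p (Y p) = VectorField.mlieBracket I X Y p :=
  have : CompleteSpace E := FiniteDimensional.complete ℝ E
  (CovariantDerivative.torsion_eq_zero_iff _).1 exists_leviCivita.choose_spec.1 hX hY

theorem leviCivita_metric {X Y Z : Π x : M, TangentSpace I x} {p : M}
    (hY : MDiffAt (T% Y) p) (hZ : MDiffAt (T% Z) p) :
    mvfderiv I (fun q ↦ (inner ℝ (Y q) (Z q) : ℝ)) p (X p)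
      = inner ℝ (leviCivita I M Y p (X p)) (Z p) + inner ℝ (Y p) (leviCivita I M Z p (X p)) :=
  exists_leviCivita.choose_spec.2.mvfderiv_inner_eq X hY hZ

/-- `R(X, Y) Z = ∇_X ∇_Y Z - ∇_Y ∇_X Z - ∇_[X, Y] Z` for vector fields `X, Y, Z`. -/
noncomputable def curvatureField (X Y Z : Π x : M, TangentSpace I x) (p : M) : TangentSpace I p :=
  leviCivita I M (fun q ↦ leviCivita I M Z q (Y q)) p (X p)
    - leviCivita I M (fun q ↦ leviCivita I M Z q (X q)) p (Y p)
    - leviCivita I M Z p (VectorField.mlieBracket I X Y p)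

/-- The curvature tensor `R(x, y) z` on tangent vectors at `p`, computed with vector fields which
are smooth near `p` and extend `x, y, z`. -/
noncomputable def curvature (p : M) (x y z : TangentSpace I p) : TangentSpace I p :=
  curvatureField (FiberBundle.extend E x) (FiberBundle.extend E y) (FiberBundle.extend E z) p

/-- The Ricci tensor `Ric(y, z) = ∑ i, R(e i, y, z, e i) = ∑ i, g(R(e i, y) z, e i)`, where `e` is
an orthonormal basis of the tangent space at `p`. -/
noncomputable def ricci (p : M) (y z : TangentSpace I p) : ℝ :=
  ∑ i, inner ℝ (curvature p (stdOrthonormalBasis ℝ (TangentSpace I p) i) y z)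
    (stdOrthonormalBasis ℝ (TangentSpace I p) i)

variable (I) in
/-- The scalar curvature `∑ i, Ric(e i, e i)`. -/
noncomputable def scalarCurvature (p : M) : ℝ :=
  ∑ i, ricci p (stdOrthonormalBasis ℝ (TangentSpace I p) i)
    (stdOrthonormalBasis ℝ (TangentSpace I p) i)

variable (I M) in
/-- `Ric = c g`. -/
def RicciEq (c : ℝ) : Prop :=
  ∀ (p : M) (x y : TangentSpace I p), ricci p x y = c * inner ℝ x y

variable (I M) in
/-- The Riemannian manifold `M` is Einstein: `Ric = c g` for some constant `c`. -/
def IsEinstein : Prop := ∃ c : ℝ, RicciEq I M c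

/-- The covariant derivative `(∇_x φ) y = ∇_x (φ y) - φ (∇_x y)` of a field `φ` of endomorphisms of
the tangent spaces. -/
noncomputable def nablaEnd (φ : Π x : M, TangentSpace I x →L[ℝ] TangentSpace I x) (p : M)
    (x y : TangentSpace I p) : TangentSpace I p :=
  leviCivita I M (fun q ↦ φ q (FiberBundle.extend E y q)) p x
    - φ p (leviCivita I M (FiberBundle.extend E y) p x)

end RiemannianGeometry

section SmoothTensors

variable {E : Type*} [NormedAddCommGroup E] [NormedSpace ℝ E]
  {H : Type*} [TopologicalSpace H] {I : ModelWithCorners ℝ E H}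
  {M : Type*} [TopologicalSpace M] [ChartedSpace H M] [IsManifold I ∞ M]

/-- `φ` is a smooth (1,1)-tensor field. -/
def SmoothEnd (φ : Π x : M, TangentSpace I x →L[ℝ] TangentSpace I x) : Prop :=
  ContMDiff I (I.prod 𝓘(ℝ, E →L[ℝ] E)) ∞
    (fun x ↦ TotalSpace.mk' (E →L[ℝ] E)
      (E := fun x : M ↦ TangentSpace I x →L[ℝ] TangentSpace I x) x (φ x))

/-- `η` is a smooth 1-form. -/
def SmoothForm (η : Π x : M, TangentSpace I x →L[ℝ] ℝ) : Prop :=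
  ContMDiff I (I.prod 𝓘(ℝ, E →L[ℝ] ℝ)) ∞
    (fun x ↦ TotalSpace.mk' (E →L[ℝ] ℝ)
      (E := fun x : M ↦ TangentSpace I x →L[ℝ] Bundle.Trivial M ℝ x) x (η x))

end SmoothTensors

/-! ### Almost paracontact paracomplex Riemannian manifolds -/

section Paracontact

variable {n : ℕ} {M : Type u} [TopologicalSpace M]
  [ChartedSpace (EuclideanSpace ℝ (Fin (2 * n + 1))) M] [IsManifold (𝓡 (2 * n + 1)) ∞ M]
  [RiemannianBundle (fun x : M ↦ TangentSpace (𝓡 (2 * n + 1)) x)]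
  [IsContMDiffRiemannianBundle (𝓡 (2 * n + 1)) ∞ (EuclideanSpace ℝ (Fin (2 * n + 1)))
    (fun x : M ↦ TangentSpace (𝓡 (2 * n + 1)) x)]

variable (n M) in
/-- An almost paracontact paracomplex Riemannian structure `(φ, ξ, η, g)` on the Riemannian manifold
`(M, g)` of dimension `2 n + 1`. Eigenvectors of `φ` for the eigenvalues `1` and `-1` lie in
`ker η`, as `η ∘ φ = 0` follows from `sq_phi` and `eta_xi`. -/
structure ApcpcR where
  /-- the structure endomorphism -/
  φ : Π x : M, TangentSpace (𝓡 (2 * n + 1)) x →L[ℝ] TangentSpace (𝓡 (2 * n + 1)) x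
  /-- the structure vector field -/
  ξ : Π x : M, TangentSpace (𝓡 (2 * n + 1)) x
  /-- the paracontact form -/
  η : Π x : M, TangentSpace (𝓡 (2 * n + 1)) x →L[ℝ] ℝ
  smooth_phi : SmoothEnd φ
  smooth_xi : ContMDiff (𝓡 (2 * n + 1)) (𝓡 (2 * n + 1)).tangent ∞
    (fun x ↦ (⟨x, ξ x⟩ : TangentBundle (𝓡 (2 * n + 1)) M))
  smooth_eta : SmoothForm η
  sq_phi : ∀ x v, φ x (φ x v) = v - η x v • ξ x
  eta_xi : ∀ x, η x (ξ x) = 1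
  finrank_one : ∀ x, Module.finrank ℝ (Module.End.eigenspace (φ x).toLinearMap (1 : ℝ)) = n
  finrank_neg_one : ∀ x, Module.finrank ℝ (Module.End.eigenspace (φ x).toLinearMap (-1 : ℝ)) = n
  inner_xi : ∀ x v, inner ℝ v (ξ x) = η x v
  inner_phi : ∀ x v w, inner ℝ (φ x v) (φ x w) = inner ℝ v w - η x v * η x w

/-- The structure tensor `F(x, y, z) = g((∇_x φ) y, z)`. -/
noncomputable def ApcpcR.F (S : ApcpcR n M) (p : M) (x y z : TangentSpace (𝓡 (2 * n + 1)) p) : ℝ :=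
  inner ℝ (nablaEnd S.φ p x y) z

/-- Para-Sasaki-like Riemannian manifolds: for `X, Y, Z` in `H = ker η`,
`F(X, Y, Z) = F(ξ, Y, Z) = F(ξ, ξ, Z) = 0` and `F(X, Y, ξ) = -g(X, Y)`. -/
structure ApcpcR.IsParaSasakiLike (S : ApcpcR n M) : Prop where
  hor : ∀ p X Y Z, S.η p X = 0 → S.η p Y = 0 → S.η p Z = 0 → S.F p X Y Z = 0
  xi_hor : ∀ p Y Z, S.η p Y = 0 → S.η p Z = 0 → S.F p (S.ξ p) Y Z = 0
  omega : ∀ p Z, S.η p Z = 0 → S.F p (S.ξ p) (S.ξ p) Z = 0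
  hor_xi : ∀ p X Y, S.η p X = 0 → S.η p Y = 0 → S.F p X Y (S.ξ p) = -inner ℝ X Y

/-- An integral manifold `N` (of dimension `2 n`) of the distribution `H = ker η`, with the
structure `(P, h)` that the restrictions `φ|_H` and `g|_H` induce on it. The inclusion of `N` is an
injective immersion: its differential is onto `H`, which has the dimension of `N`. -/
structure IntegralManifold (S : ApcpcR n M) where
  /-- the underlying type of `N` -/
  carrier : Type u
  [topologicalSpace : TopologicalSpace carrier]
  [t2Space : T2Space carrier]
  [secondCountableTopology : SecondCountableTopology carrier]
  [chartedSpace : ChartedSpace (EuclideanSpace ℝ (Fin (2 * n))) carrier]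
  [isManifold : IsManifold (𝓡 (2 * n)) ∞ carrier]
  /-- the metric `h` -/
  [riemannianBundle : RiemannianBundle (fun x : carrier ↦ TangentSpace (𝓡 (2 * n)) x)]
  [isContMDiffRiemannianBundle :
    IsContMDiffRiemannianBundle (𝓡 (2 * n)) ∞ (EuclideanSpace ℝ (Fin (2 * n)))
      (fun x : carrier ↦ TangentSpace (𝓡 (2 * n)) x)]
  /-- the inclusion of `N` into `M` -/
  incl : carrier → M
  contMDiff_incl : ContMDiff (𝓡 (2 * n)) (𝓡 (2 * n + 1)) ∞ incl
  injective_incl : Function.Injective incl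
  range_mfderiv : ∀ p, (mfderiv (𝓡 (2 * n)) (𝓡 (2 * n + 1)) incl p).range = (S.η (incl p)).ker
  inner_eq : ∀ (p : carrier) (u v : TangentSpace (𝓡 (2 * n)) p),
    inner ℝ u v = inner ℝ (mfderiv (𝓡 (2 * n)) (𝓡 (2 * n + 1)) incl p u)
      (mfderiv (𝓡 (2 * n)) (𝓡 (2 * n + 1)) incl p v)
  /-- the endomorphism field `P` -/
  P : Π p : carrier, TangentSpace (𝓡 (2 * n)) p →L[ℝ] TangentSpace (𝓡 (2 * n)) p
  mfderiv_P : ∀ (p : carrier) (u : TangentSpace (𝓡 (2 * n)) p),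
    mfderiv (𝓡 (2 * n)) (𝓡 (2 * n + 1)) incl p (P p u)
      = S.φ (incl p) (mfderiv (𝓡 (2 * n)) (𝓡 (2 * n + 1)) incl p u)

attribute [instance] IntegralManifold.topologicalSpace IntegralManifold.t2Space
  IntegralManifold.secondCountableTopology IntegralManifold.chartedSpace
  IntegralManifold.isManifold IntegralManifold.riemannianBundle
  IntegralManifold.isContMDiffRiemannianBundle

end Paracontact

section Paracomplex

variable {n : ℕ} {N : Type*} [TopologicalSpace N]
  [ChartedSpace (EuclideanSpace ℝ (Fin (2 * n))) N] [IsManifold (𝓡 (2 * n)) ∞ N]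
  [RiemannianBundle (fun x : N ↦ TangentSpace (𝓡 (2 * n)) x)]
  [IsContMDiffRiemannianBundle (𝓡 (2 * n)) ∞ (EuclideanSpace ℝ (Fin (2 * n)))
    (fun x : N ↦ TangentSpace (𝓡 (2 * n)) x)]

/-- `(N, P, h)` is a paraholomorphic paracomplex Riemannian (phpcR) manifold of dimension `2 n`,
where `h` is the Riemannian metric of `N`. -/
structure IsPhpcR (P : Π p : N, TangentSpace (𝓡 (2 * n)) p →L[ℝ] TangentSpace (𝓡 (2 * n)) p) :
    Prop where
  smooth : SmoothEnd P
  sq : ∀ p u, P p (P p u) = u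
  finrank_one : ∀ p, Module.finrank ℝ (Module.End.eigenspace (P p).toLinearMap (1 : ℝ)) = n
  finrank_neg_one : ∀ p, Module.finrank ℝ (Module.End.eigenspace (P p).toLinearMap (-1 : ℝ)) = n
  inner_P : ∀ p u v, inner ℝ (P p u) (P p v) = inner ℝ u v
  nabla_P : ∀ p u v, nablaEnd P p u v = 0

end Paracomplex

end ParaSasaki

/-!
The first step is to find the covariant derivatives of the structure tensors. The conditions on `F`
determine `∇_x ξ = φ x` (`nabla_xi`) and `(∇_x φ) y = (2 η(x) η(y) - g(x, y)) ξ - η(y) x`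
(`nablaEnd_phi`). Hence `R(x, y) ξ = η(x) y - η(y) x` (`curvature_xi`) and `Ric(y, ξ) = -2n η(y)`
(`ricci_xi`): along `ξ` the manifold `M` always behaves like an Einstein manifold, and the only
possible Einstein constant is `-2n`.

An integral manifold `N` of `H = ker η` is a hypersurface with unit normal `ξ` and shape operator
`-P`. Its connection is the horizontal part of that of `M` (`related_nabla`), which gives
`∇^h P = 0`, because `(∇_x φ) y` is vertical for horizontal `x`, `y`. In the Gauss equation
(`inner_curvature_dincl`) the second fundamental form contributes
`g(P y, P z) - tr P · g(P y, z) = g(y, z)` to the Ricci tensor of `M`, for `P` is an isometry with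
`tr P = 0`, its two eigenspaces having the same dimension. This cancels against the summand
`g(R(ξ, y) z, ξ) = -g(y, z)` of the normal direction, so the Ricci tensor of `N` is exactly the
restriction of the Ricci tensor of `M` (`ricci_dincl`). Both equivalences with the
Einstein condition follow, using one integral manifold through each point for the converse.

Integral manifolds exist because `φ` is symmetric, so that `∇ξ = φ` makes `η` closed
(`eta_closed`). By the Poincaré lemma `η` is locally `df` (`exists_primitive`), and the inverse
function theorem parametrizes a level set of `f` by an open subset of the Euclidean space
(`exists_level_parametrization`), which carries the metric and the endomorphism field induced from
`M` (`exists_integralManifold_of_immersion`). Closedness makes the Frobenius theorem unnecessary.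

Throughout, tensors at a point are computed with globally defined smooth vector fields, obtained
with bump functions (`exists_contMDiff_eventuallyEq`); on `N` they are restrictions of horizontal
fields of `M` (`IntegralManifold.Related`).
-/

set_option linter.unusedSectionVars false

namespace ParaSasaki

/-! ### Smooth vector fields and tensor fields -/

section VectorFields

variable {E : Type*} [NormedAddCommGroup E] [NormedSpace ℝ E] [FiniteDimensional ℝ E]
  {H : Type*} [TopologicalSpace H] {I : ModelWithCorners ℝ E H}
  {M : Type*} [TopologicalSpace M] [ChartedSpace H M] [IsManifold I ∞ M]
  {E' : Type*} [NormedAddCommGroup E'] [NormedSpace ℝ E'] [FiniteDimensional ℝ E']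
  {H' : Type*} [TopologicalSpace H'] {I' : ModelWithCorners ℝ E' H'}
  {M' : Type*} [TopologicalSpace M'] [ChartedSpace H' M'] [IsManifold I' ∞ M']

omit [FiniteDimensional ℝ E] [FiniteDimensional ℝ E'] in
theorem contMDiffAt_mfderiv_apply {f : M → M'} {X : Π x : M, TangentSpace I x} {p : M}
    (hf : CMDiffAt ∞ f p) (hX : CMDiffAt ∞ (T% X) p) :
    ContMDiffAt I I'.tangent ∞
      (fun q ↦ (⟨f q, mfderiv I I' f q (X q)⟩ : TangentBundle I' M')) p := by
  have h := hf.mfderiv_const (m := ∞) (by simp)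
  exact ContMDiffAt.clm_apply_of_inCoordinates (E₁ := fun x : M ↦ TangentSpace I x)
    (E₂ := fun x : M' ↦ TangentSpace I' x) h hX hf

omit [FiniteDimensional ℝ E] in
theorem contMDiffAt_mvfderiv_apply {f : M → ℝ} {X : Π x : M, TangentSpace I x} {p : M}
    (hf : CMDiffAt ∞ f p) (hX : CMDiffAt ∞ (T% X) p) :
    CMDiffAt ∞ (fun q ↦ mvfderiv I f q (X q)) p := by
  have h := contMDiffAt_mfderiv_apply (I' := 𝓘(ℝ, ℝ)) hf hX
  exact (contMDiff_snd_tangentBundle_modelSpace ℝ 𝓘(ℝ, ℝ)).contMDiffAt.comp p h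

/-- A vector field which is smooth near `p` agrees near `p` with a globally smooth one. -/
theorem exists_contMDiff_eventuallyEq [T2Space M] {X : Π x : M, TangentSpace I x} {p : M}
    {s : Set M} (hs : s ∈ nhds p) (hX : CMDiff[s] ∞ (T% X)) :
    ∃ Y : Π x : M, TangentSpace I x, CMDiff ∞ (T% Y) ∧ ∀ᶠ q in nhds p, Y q = X q := by
  obtain ⟨t, hts, ht, hpt⟩ := mem_nhds_iff.1 hs
  obtain ⟨f, -, hf⟩ := (SmoothBumpFunction.nhds_basis_tsupport (I := I) p).mem_iff.1
    (ht.mem_nhds hpt)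
  refine ⟨(f : M → ℝ) • X, ContMDiffOn.smul_section_of_tsupport f.contMDiff.contMDiffOn ht hf
    (hX.mono hts), ?_⟩
  filter_upwards [f.eventuallyEq_one] with q hq
  simp [hq]

theorem exists_contMDiff_eq_extend [T2Space M] {p : M} (v : TangentSpace I p) :
    ∃ Y : Π x : M, TangentSpace I x, CMDiff ∞ (T% Y) ∧
      ∀ᶠ q in nhds p, Y q = FiberBundle.extend E v q := by
  obtain ⟨s, hs, h⟩ := FiberBundle.exists_contMDiffOn_extend (k := ∞) I E
    (V := fun x : M ↦ TangentSpace I x) v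
  exact exists_contMDiff_eventuallyEq hs h

theorem exists_contMDiff_apply_eq [T2Space M] {p : M} (v : TangentSpace I p) :
    ∃ Y : Π x : M, TangentSpace I x, CMDiff ∞ (T% Y) ∧ Y p = v := by
  obtain ⟨Y, hY, h⟩ := exists_contMDiff_eq_extend v
  exact ⟨Y, hY, by simpa using h.self_of_nhds⟩

theorem exists_contMDiff_function_eventuallyEq [T2Space M] {f : M → ℝ} {p : M} {s : Set M}
    (hs : s ∈ nhds p) (hf : CMDiff[s] ∞ f) :
    ∃ g : M → ℝ, CMDiff ∞ g ∧ ∀ᶠ q in nhds p, g q = f q := by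
  obtain ⟨t, hts, ht, hpt⟩ := mem_nhds_iff.1 hs
  obtain ⟨b, -, hb⟩ := (SmoothBumpFunction.nhds_basis_tsupport (I := I) p).mem_iff.1
    (ht.mem_nhds hpt)
  refine ⟨fun q ↦ b q • f q, ?_, ?_⟩
  · intro q
    by_cases hq : q ∈ tsupport b
    · exact b.contMDiff.contMDiffAt.smul ((hf.mono hts).contMDiffAt (ht.mem_nhds (hb hq)))
    · refine (contMDiffAt_const (c := (0 : ℝ))).congr_of_eventuallyEq ?_
      have := (isClosed_tsupport b).isOpen_compl.mem_nhds hq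
      filter_upwards [this] with x hx
      simp [image_eq_zero_of_notMem_tsupport hx]
  · filter_upwards [b.eventuallyEq_one] with q hq
    simp [hq]

theorem contMDiff_mlieBracket {X Y : Π x : M, TangentSpace I x}
    (hX : CMDiff ∞ (T% X)) (hY : CMDiff ∞ (T% Y)) :
    CMDiff ∞ (T% (VectorField.mlieBracket I X Y)) := by
  have : CompleteSpace E := FiniteDimensional.complete ℝ E
  have : IsManifold I (((⊤ : ℕ∞) : ℕ∞ω) + 1) M := by simpa using ‹IsManifold I ∞ M›
  have : IsManifold I (minSmoothness ℝ 3) M := by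
    rw [minSmoothness_of_isRCLikeNormedField]; infer_instance
  exact ContDiff.mlieBracket_vectorField (n := ⊤) (m := ⊤) hX hY (by simp)

omit [FiniteDimensional ℝ E] [IsManifold I ∞ M] in
theorem contMDiffAt_det {ι : Type*} [Fintype ι] [DecidableEq ι] {A : M → Matrix ι ι ℝ} {p : M}
    (hA : ∀ i j, CMDiffAt ∞ (fun q ↦ A q i j) p) : CMDiffAt ∞ (fun q ↦ (A q).det) p := by
  simp only [Matrix.det_apply']
  refine ContMDiffAt.sum fun σ _ ↦ contMDiffAt_const.mul ?_
  exact ContMDiffAt.prod fun i _ ↦ hA _ _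

/-- A vector field is smooth if its scalar products with all smooth vector fields are. -/
theorem contMDiff_of_inner [RiemannianBundle (fun x : M ↦ TangentSpace I x)]
    [IsContMDiffRiemannianBundle I ∞ E (fun x : M ↦ TangentSpace I x)] [T2Space M]
    {X : Π x : M, TangentSpace I x}
    (h : ∀ W : Π x : M, TangentSpace I x, CMDiff ∞ (T% W) →
      CMDiff ∞ (fun q ↦ (inner ℝ (X q) (W q) : ℝ))) : CMDiff ∞ (T% X) := by
  classical
  intro p
  let t := trivializationAt E (fun x : M ↦ TangentSpace I x) p
  have hp : p ∈ t.baseSet := FiberBundle.mem_baseSet_trivializationAt' p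
  let b := Module.finBasis ℝ E
  let e := t.localFrame b
  have he : IsLocalFrameOn I E ∞ e t.baseSet := t.isLocalFrameOn_localFrame_baseSet I ∞ b
  have hes (i) : CMDiff[t.baseSet] ∞ (T% (e i)) := t.contMDiffOn_localFrame_baseSet ∞ b i
  choose W hW hWe using fun i ↦ exists_contMDiff_eventuallyEq (t.open_baseSet.mem_nhds hp) (hes i)
  -- the coefficients of `X` in a frame solve a linear system whose matrix is the Gram matrix of the
  -- frame; Cramer's rule shows that they are smooth
  let G : M → Matrix _ _ ℝ := fun q ↦ Matrix.of fun i j ↦ inner ℝ (W i q) (W j q)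
  let a : M → _ → ℝ := fun q i ↦ inner ℝ (X q) (W i q)
  have hG (i j) : CMDiff ∞ (fun q ↦ G q i j) :=
    ContMDiff.inner_bundle (E := fun x : M ↦ TangentSpace I x) (F := E) (hW i) (hW j)
  have ha (i) : CMDiff ∞ (fun q ↦ a q i) := h _ (hW i)
  let c : M → _ → ℝ := fun q i ↦ t.localFrameCoeff I b i q (X q)
  have hdet : ∀ᶠ q in nhds p, (G q).det ≠ 0 ∧ (G q).mulVec (c q) = a q := by
    filter_upwards [Filter.eventually_all.2 hWe, t.open_baseSet.mem_nhds hp] with q hq hqt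
    refine ⟨?_, ?_⟩
    · have := Matrix.posDef_gram_of_linearIndependent (𝕜 := ℝ) (he.linearIndependent hqt)
      have h2 := this.det_pos.ne'
      convert! h2 using 3
      ext i j
      simp [G, hq, Matrix.gram]
    · ext j
      have h1 : X q = ∑ i, c q i • e i q := t.eq_sum_localFrameCoeff_smul hqt
      simp only [a]
      rw [hq j]
      conv_rhs => rw [h1]
      simp only [Matrix.mulVec, dotProduct, G, Matrix.of_apply, sum_inner, inner_smul_left, hq]
      refine Finset.sum_congr rfl fun i _ ↦ ?_
      rw [real_inner_comm]
      simp [mul_comm]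
  rw [contMDiffAt_iff_localFrameCoeff b hp]
  intro i
  have hdc : CMDiffAt ∞ (fun q ↦ (((G q).updateCol i (a q)).det) / (G q).det) p := by
    refine (contMDiffAt_det fun k l ↦ ?_).div₀ (contMDiffAt_det fun k l ↦ hG k l p)
      hdet.self_of_nhds.1
    by_cases hl : l = i
    · subst hl; simpa using ha k p
    · simpa [Matrix.updateCol_ne hl] using hG k l p
  refine hdc.congr_of_eventuallyEq ?_
  filter_upwards [hdet] with q hq
  have h1 := Matrix.cramer_apply (G q) (a q) i
  rw [← h1, ← hq.2, Matrix.cramer_eq_adjugate_mulVec, Matrix.mulVec_mulVec, Matrix.adjugate_mul]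
  simp [Matrix.smul_mulVec, hq.1]
  rfl

omit [FiniteDimensional ℝ E'] [IsManifold I ∞ M] in
theorem contMDiffAt_clm_of_basis {ι : Type*} [Fintype ι] (b : Module.Basis ι ℝ E)
    {f : M → E →L[ℝ] E'} {p : M} (h : ∀ i, CMDiffAt ∞ (fun q ↦ f q (b i)) p) :
    CMDiffAt ∞ f p := by
  have : f = fun q ↦ ∑ i, (ContinuousLinearMap.smulRightL ℝ E E'
      (LinearMap.toContinuousLinearMap (b.coord i))) (f q (b i)) := by
    ext q v
    conv_lhs => rw [← b.sum_repr v, map_sum]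
    simp [-Module.Basis.sum_repr]
  rw [this]
  refine ContMDiffAt.sum fun i _ ↦ ?_
  exact (ContinuousLinearMap.contMDiff _).contMDiffAt.comp p (h i)

omit [FiniteDimensional ℝ E'] in
/-- A field of linear maps on the tangent spaces is smooth if it sends smooth vector fields to
smooth sections. -/
theorem contMDiff_hom_of_apply [T2Space M] {V : M → Type*}
    [TopologicalSpace (TotalSpace E' V)] [∀ x, AddCommGroup (V x)] [∀ x, Module ℝ (V x)]
    [∀ x, TopologicalSpace (V x)] [∀ x, IsTopologicalAddGroup (V x)]
    [∀ x, ContinuousSMul ℝ (V x)] [FiberBundle E' V] [VectorBundle ℝ E' V]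
    {T : Π x : M, TangentSpace I x →L[ℝ] V x}
    (h : ∀ X : Π x : M, TangentSpace I x, CMDiff ∞ (T% X) →
      ContMDiff I (I.prod 𝓘(ℝ, E')) ∞ (fun q ↦ TotalSpace.mk' E' (E := V) q (T q (X q)))) :
    ContMDiff I (I.prod 𝓘(ℝ, E →L[ℝ] E')) ∞
      (fun q ↦ TotalSpace.mk' (E →L[ℝ] E') (E := fun x : M ↦ TangentSpace I x →L[ℝ] V x) q (T q)) := by
  intro p
  rw [contMDiffAt_hom_bundle]
  refine ⟨contMDiffAt_id, contMDiffAt_clm_of_basis (Module.finBasis ℝ E) fun i ↦ ?_⟩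
  let t := trivializationAt E (fun x : M ↦ TangentSpace I x) p
  have hp : p ∈ t.baseSet := FiberBundle.mem_baseSet_trivializationAt' p
  have hp' : p ∈ (trivializationAt E' V p).baseSet := FiberBundle.mem_baseSet_trivializationAt' p
  have hes : CMDiff[t.baseSet] ∞ (T% (t.localFrame (Module.finBasis ℝ E) i)) :=
    t.contMDiffOn_localFrame_baseSet ∞ _ i
  obtain ⟨W, hW, hWe⟩ := exists_contMDiff_eventuallyEq (t.open_baseSet.mem_nhds hp) hes
  have h1 := (contMDiffAt_section p).1 (h W hW p)
  refine h1.congr_of_eventuallyEq ?_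
  filter_upwards [hWe, t.open_baseSet.mem_nhds hp,
    (trivializationAt E' V p).open_baseSet.mem_nhds hp'] with q hq hqt hqt'
  rw [hq, t.localFrame_apply_of_mem_baseSet _ hqt]
  simp [ContinuousLinearMap.inCoordinates, Trivialization.basisAt, hqt',
    Trivialization.continuousLinearMapAt_apply]
  exact congrArg (fun v ↦ (trivializationAt E' V p ⟨q, T q v⟩).2) (t.symmL_apply hqt _)

omit [FiniteDimensional ℝ E] in
theorem mdiffAt_of_contMDiff {X : Π x : M, TangentSpace I x} (hX : CMDiff ∞ (T% X)) (p : M) :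
    MDiffAt (T% X) p :=
  (hX p).mdifferentiableAt (by simp)

/-- The Lie bracket is the commutator of the two derivations: compare the coefficients of a field
`Z` in the Jacobi identity for `X`, `Y`, `f Z`, where `Z p ≠ 0`. -/
theorem mvfderiv_mlieBracket [T2Space M] {X Y : Π x : M, TangentSpace I x} {f : M → ℝ}
    (hX : CMDiff ∞ (T% X)) (hY : CMDiff ∞ (T% Y)) (hf : CMDiff ∞ f) (p : M) :
    mvfderiv I f p (VectorField.mlieBracket I X Y p)
      = mvfderiv I (fun q ↦ mvfderiv I f q (Y q)) p (X p)
        - mvfderiv I (fun q ↦ mvfderiv I f q (X q)) p (Y p) := by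
  have : CompleteSpace E := FiniteDimensional.complete ℝ E
  have : IsManifold I (minSmoothness ℝ 3) M := by
    rw [minSmoothness_of_isRCLikeNormedField]; infer_instance
  by_cases hv : ∃ v : TangentSpace I p, v ≠ 0
  · obtain ⟨v, hv⟩ := hv
    obtain ⟨Z, hZ, rfl⟩ := exists_contMDiff_apply_eq v
    have hfd (q) : MDiffAt f q := (hf q).mdifferentiableAt (by simp)
    have hXY := contMDiff_mlieBracket hX hY
    have hYZ := contMDiff_mlieBracket hY hZ
    have hXZ := contMDiff_mlieBracket hX hZ
    have hYf : CMDiff ∞ (fun q ↦ mvfderiv I f q (Y q)) := fun q ↦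
      contMDiffAt_mvfderiv_apply (hf q) (hY q)
    have hXf : CMDiff ∞ (fun q ↦ mvfderiv I f q (X q)) := fun q ↦
      contMDiffAt_mvfderiv_apply (hf q) (hX q)
    -- `[V, f Z] = (V f) Z + f [V, Z]`
    have key (V : Π x : M, TangentSpace I x) : VectorField.mlieBracket I V (f • Z)
        = (fun q ↦ mvfderiv I f q (V q)) • Z + f • VectorField.mlieBracket I V Z := by
      funext q
      rw [VectorField.mlieBracket_smul_right (hfd q) (mdiffAt_of_contMDiff hZ q)]
      rfl
    have h2 : minSmoothness ℝ 2 ≤ ∞ := by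
      rw [minSmoothness_of_isRCLikeNormedField]; exact ENat.LEInfty.out
    have jac := VectorField.leibniz_identity_mlieBracket_apply (I := I) (U := X) (V := Y)
      (W := f • Z) (x := p) ((hX p).of_le h2) ((hY p).of_le h2)
      (((hf p).smul_section (hZ p)).of_le h2)
    have jac' := VectorField.leibniz_identity_mlieBracket_apply (I := I) (U := X) (V := Y)
      (W := Z) (x := p) ((hX p).of_le h2) ((hY p).of_le h2)
      ((hZ p).of_le h2)
    have d (g : M → ℝ) (hg : CMDiff ∞ g) (W : Π x : M, TangentSpace I x)
        (hW : CMDiff ∞ (T% W)) : MDiffAt (T% (g • W)) p :=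
      mdiffAt_of_contMDiff (hg.smul_section hW) p
    rw [key, key, key,
      VectorField.mlieBracket_add_right (d _ hYf _ hZ) (d _ hf _ hYZ),
      VectorField.mlieBracket_add_right (d _ hXf _ hZ) (d _ hf _ hXZ)] at jac
    have hm (g : M → ℝ) (hg : CMDiff ∞ g) : MDiffAt g p := (hg p).mdifferentiableAt (by simp)
    rw [VectorField.mlieBracket_smul_right (hm _ hYf) (mdiffAt_of_contMDiff hZ p),
      VectorField.mlieBracket_smul_right (hm _ hXf) (mdiffAt_of_contMDiff hZ p),
      VectorField.mlieBracket_smul_right (hm _ hf) (mdiffAt_of_contMDiff hYZ p),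
      VectorField.mlieBracket_smul_right (hm _ hf) (mdiffAt_of_contMDiff hXZ p), jac'] at jac
    simp only [Pi.add_apply, Pi.smul_apply'] at jac
    have : (mvfderiv I f p (VectorField.mlieBracket I X Y p)
      - (mvfderiv I (fun q ↦ mvfderiv I f q (Y q)) p (X p)
        - mvfderiv I (fun q ↦ mvfderiv I f q (X q)) p (Y p))) • Z p = 0 := by
      rw [← sub_eq_zero] at jac
      rw [← neg_eq_zero, ← jac]
      module
    rcases smul_eq_zero.1 this with h | h
    · linarith
    · exact absurd h hv
  -- in dimension zero both sides vanish
  · push Not at hv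
    rw [hv (X p), hv (Y p), hv (VectorField.mlieBracket I X Y p)]
    simp

end VectorFields

/-! ### The Levi-Civita connection and the symmetries of its curvature -/

section LeviCivita

variable {E : Type*} [NormedAddCommGroup E] [NormedSpace ℝ E] [FiniteDimensional ℝ E]
  {H : Type*} [TopologicalSpace H] {I : ModelWithCorners ℝ E H}
  {M : Type*} [TopologicalSpace M] [ChartedSpace H M] [IsManifold I ∞ M]
  [RiemannianBundle (fun x : M ↦ TangentSpace I x)]
  [IsContMDiffRiemannianBundle I ∞ E (fun x : M ↦ TangentSpace I x)]

/-- The vector field `∇_X Y`. -/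
noncomputable def nabla (X Y : Π x : M, TangentSpace I x) (p : M) : TangentSpace I p :=
  leviCivita I M Y p (X p)

omit [FiniteDimensional ℝ E] in
theorem contMDiff_inner {X Y : Π x : M, TangentSpace I x}
    (hX : CMDiff ∞ (T% X)) (hY : CMDiff ∞ (T% Y)) :
    CMDiff ∞ (fun q ↦ (inner ℝ (X q) (Y q) : ℝ)) :=
  ContMDiff.inner_bundle (E := fun x : M ↦ TangentSpace I x) (F := E) hX hY

variable {X Y Z W : Π x : M, TangentSpace I x}

theorem mvfderiv_inner (hY : CMDiff ∞ (T% Y)) (hZ : CMDiff ∞ (T% Z)) (p : M) :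
    mvfderiv I (fun q ↦ (inner ℝ (Y q) (Z q) : ℝ)) p (X p)
      = inner ℝ (nabla X Y p) (Z p) + inner ℝ (Y p) (nabla X Z p) :=
  leviCivita_metric (mdiffAt_of_contMDiff hY p) (mdiffAt_of_contMDiff hZ p)

theorem nabla_sub_nabla_swap (hX : CMDiff ∞ (T% X)) (hY : CMDiff ∞ (T% Y)) (p : M) :
    nabla X Y p - nabla Y X p = VectorField.mlieBracket I X Y p :=
  leviCivita_torsion (mdiffAt_of_contMDiff hX p) (mdiffAt_of_contMDiff hY p)

/-- The Koszul formula. -/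
theorem two_mul_inner_nabla (hX : CMDiff ∞ (T% X)) (hY : CMDiff ∞ (T% Y)) (hZ : CMDiff ∞ (T% Z))
    (p : M) : 2 * inner ℝ (nabla X Y p) (Z p) = koszul X Y Z p := by
  rw [koszul, mvfderiv_inner hY hZ, mvfderiv_inner hZ hX, mvfderiv_inner hX hY,
    ← nabla_sub_nabla_swap hX hY, ← nabla_sub_nabla_swap hZ hX, ← nabla_sub_nabla_swap hZ hY]
  simp only [inner_sub_left]
  rw [real_inner_comm (nabla X Z p) (Y p), real_inner_comm (nabla Y X p) (Z p),
    real_inner_comm (nabla Z Y p) (X p)]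
  ring

/-- The Levi-Civita connection preserves smoothness. -/
theorem contMDiff_nabla [T2Space M] (hX : CMDiff ∞ (T% X)) (hY : CMDiff ∞ (T% Y)) :
    CMDiff ∞ (T% (nabla X Y)) := by
  refine contMDiff_of_inner fun Z hZ ↦ ?_
  have h (q : M) : (inner ℝ (nabla X Y q) (Z q) : ℝ) = (1 / 2) * koszul X Y Z q := by
    rw [← two_mul_inner_nabla hX hY hZ]; ring
  simp only [h, koszul]
  have d (A B C : Π x : M, TangentSpace I x) (hA : CMDiff ∞ (T% A)) (hB : CMDiff ∞ (T% B))
      (hC : CMDiff ∞ (T% C)) :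
      CMDiff ∞ (fun q ↦ mvfderiv I (fun q ↦ (inner ℝ (A q) (B q) : ℝ)) q (C q)) :=
    fun q ↦ contMDiffAt_mvfderiv_apply (contMDiff_inner hA hB q) (hC q)
  have e (A B C : Π x : M, TangentSpace I x) (hA : CMDiff ∞ (T% A)) (hB : CMDiff ∞ (T% B))
      (hC : CMDiff ∞ (T% C)) :
      CMDiff ∞ (fun q ↦ (inner ℝ (VectorField.mlieBracket I A B q) (C q) : ℝ)) :=
    contMDiff_inner (contMDiff_mlieBracket hA hB) hC
  exact contMDiff_const.mul ((((((d _ _ _ hY hZ hX).add (d _ _ _ hZ hX hY)).sub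
    (d _ _ _ hX hY hZ)).add (e _ _ _ hX hY hZ)).add (e _ _ _ hZ hX hY)).add (e _ _ _ hZ hY hX))

theorem nabla_add_right (hY : CMDiff ∞ (T% Y)) (hZ : CMDiff ∞ (T% Z)) (p : M) :
    nabla X (Y + Z) p = nabla X Y p + nabla X Z p := by
  simp only [nabla]
  rw [(leviCivita I M).isCovariantDerivativeOn.add (mdiffAt_of_contMDiff hY p)
    (mdiffAt_of_contMDiff hZ p) (Set.mem_univ p)]
  rfl

theorem nabla_smul_right {f : M → ℝ} (hf : CMDiff ∞ f) (hY : CMDiff ∞ (T% Y)) (p : M) :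
    nabla X (f • Y) p = mvfderiv I f p (X p) • Y p + f p • nabla X Y p := by
  simp only [nabla]
  rw [(leviCivita I M).isCovariantDerivativeOn.leibniz (mdiffAt_of_contMDiff hY p)
    ((hf p).mdifferentiableAt (by simp)) (Set.mem_univ p)]
  simp [add_comm]

theorem nabla_neg_right (hY : CMDiff ∞ (T% Y)) (p : M) : nabla X (-Y) p = -nabla X Y p := by
  have h := nabla_smul_right (X := X) (f := fun _ ↦ (-1 : ℝ)) contMDiff_const hY p
  have e : (fun _ : M ↦ (-1 : ℝ)) • Y = -Y := by ext q; simp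
  rw [e, mvfderiv_const] at h
  simpa using h

theorem nabla_sub_right (hY : CMDiff ∞ (T% Y)) (hZ : CMDiff ∞ (T% Z)) (p : M) :
    nabla X (Y - Z) p = nabla X Y p - nabla X Z p := by
  rw [sub_eq_add_neg, nabla_add_right hY hZ.neg_section, nabla_neg_right hZ, sub_eq_add_neg]

theorem nabla_congr_left {X' : Π x : M, TangentSpace I x} {p : M} (h : X p = X' p) :
    nabla X Y p = nabla X' Y p := by simp only [nabla, h]

theorem nabla_congr_right {Y' : Π x : M, TangentSpace I x} {p : M} (hY : MDiffAt (T% Y) p)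
    (hY' : MDiffAt (T% Y') p) (h : ∀ᶠ q in nhds p, Y q = Y' q) :
    nabla X Y p = nabla X Y' p := by
  simp only [nabla]
  rw [(leviCivita I M).isCovariantDerivativeOn.congr_of_eventuallyEq hY hY' Filter.univ_mem h]

theorem curvatureField_eq (X Y Z : Π x : M, TangentSpace I x) (p : M) :
    curvatureField X Y Z p = nabla X (nabla Y Z) p - nabla Y (nabla X Z) p
      - nabla (VectorField.mlieBracket I X Y) Z p := rfl

theorem curvatureField_swap (p : M) :
    curvatureField Y X Z p = -curvatureField X Y Z p := by
  have h : nabla (VectorField.mlieBracket I Y X) Z p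
      = -nabla (VectorField.mlieBracket I X Y) Z p := by
    simp only [nabla]
    rw [VectorField.mlieBracket_swap_apply, map_neg]
  rw [curvatureField_eq, curvatureField_eq, h]
  abel

variable [T2Space M]

/-- `g(R(X, Y) Z, W)` is skew in `Z`, `W`, since `[X, Y]` is the commutator of the derivations `X`
and `Y` on the function `g(Z, W)`. -/
theorem inner_curvatureField_skew (hX : CMDiff ∞ (T% X)) (hY : CMDiff ∞ (T% Y))
    (hZ : CMDiff ∞ (T% Z)) (hW : CMDiff ∞ (T% W)) (p : M) :
    (inner ℝ (curvatureField X Y Z p) (W p) : ℝ) = -inner ℝ (curvatureField X Y W p) (Z p) := by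
  have second (A B : Π x : M, TangentSpace I x) (hA : CMDiff ∞ (T% A)) (hB : CMDiff ∞ (T% B)) :
      mvfderiv I (fun q ↦ mvfderiv I (fun q ↦ (inner ℝ (Z q) (W q) : ℝ)) q (B q)) p (A p)
      = inner ℝ (nabla A (nabla B Z) p) (W p) + inner ℝ (nabla B Z p) (nabla A W p)
        + inner ℝ (nabla A Z p) (nabla B W p) + inner ℝ (Z p) (nabla A (nabla B W) p) := by
    have hBZ := contMDiff_nabla hB hZ
    have hBW := contMDiff_nabla hB hW
    have e : (fun q ↦ mvfderiv I (fun q ↦ (inner ℝ (Z q) (W q) : ℝ)) q (B q))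
        = fun q ↦ inner ℝ (nabla B Z q) (W q) + inner ℝ (Z q) (nabla B W q) := by
      funext q; exact mvfderiv_inner hZ hW q
    rw [e, mvfderiv_fun_add ((contMDiff_inner hBZ hW p).mdifferentiableAt (by simp))
      ((contMDiff_inner hZ hBW p).mdifferentiableAt (by simp)), add_apply,
      mvfderiv_inner hBZ hW, mvfderiv_inner hZ hBW]
    ring
  have h := mvfderiv_mlieBracket hX hY (contMDiff_inner hZ hW) p
  rw [second X Y hX hY, second Y X hY hX, mvfderiv_inner hZ hW] at h
  rw [curvatureField_eq, curvatureField_eq, inner_sub_left, inner_sub_left, inner_sub_left,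
    inner_sub_left]
  rw [real_inner_comm (Z p) (nabla X (nabla Y W) p), real_inner_comm (Z p) (nabla Y (nabla X W) p),
    real_inner_comm (Z p) (nabla (VectorField.mlieBracket I X Y) W p)]
  linarith

/-- The first Bianchi identity. -/
theorem curvatureField_bianchi (hX : CMDiff ∞ (T% X)) (hY : CMDiff ∞ (T% Y))
    (hZ : CMDiff ∞ (T% Z)) (p : M) :
    curvatureField X Y Z p + curvatureField Y Z X p + curvatureField Z X Y p = 0 := by
  have : CompleteSpace E := FiniteDimensional.complete ℝ E
  have : IsManifold I (minSmoothness ℝ 3) M := by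
    rw [minSmoothness_of_isRCLikeNormedField]; infer_instance
  have h2 : minSmoothness ℝ 2 ≤ ∞ := by
    rw [minSmoothness_of_isRCLikeNormedField]; exact ENat.LEInfty.out
  have key (A B C : Π x : M, TangentSpace I x) (hA : CMDiff ∞ (T% A)) (hB : CMDiff ∞ (T% B))
      (hC : CMDiff ∞ (T% C)) : nabla A (nabla B C) p - nabla A (nabla C B) p
        - nabla (VectorField.mlieBracket I B C) A p
        = VectorField.mlieBracket I A (VectorField.mlieBracket I B C) p := by
    have e : VectorField.mlieBracket I B C = nabla B C - nabla C B := by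
      funext q; exact (nabla_sub_nabla_swap hB hC q).symm
    have hBC := contMDiff_mlieBracket hB hC
    rw [← nabla_sub_nabla_swap hA hBC, ← nabla_sub_right (contMDiff_nabla hB hC)
      (contMDiff_nabla hC hB), ← e]
  have jac := VectorField.leibniz_identity_mlieBracket_apply (I := I) (U := X) (V := Y)
    (W := Z) (x := p) ((hX p).of_le h2) ((hY p).of_le h2) ((hZ p).of_le h2)
  have k1 := key X Y Z hX hY hZ
  have k2 := key Y Z X hY hZ hX
  have k3 := key Z X Y hZ hX hY
  have s1 : VectorField.mlieBracket I (VectorField.mlieBracket I X Y) Z p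
    = - VectorField.mlieBracket I Z (VectorField.mlieBracket I X Y) p :=
      VectorField.mlieBracket_swap_apply
  have s2 : VectorField.mlieBracket I Y (VectorField.mlieBracket I X Z) p
    = - VectorField.mlieBracket I Y (VectorField.mlieBracket I Z X) p := by
      rw [VectorField.mlieBracket_swap (V := X)]
      have := VectorField.mlieBracket_const_smul_right (I := I) (V := Y) (c := (-1 : ℝ))
        (mdiffAt_of_contMDiff (contMDiff_mlieBracket hZ hX) p)
      simpa using this
  rw [s1, s2, ← k1, ← k2, ← k3] at jac
  simp only [curvatureField_eq]
  rw [← sub_eq_zero] at jac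
  rw [← jac]
  abel

theorem inner_curvatureField_pair (hX : CMDiff ∞ (T% X)) (hY : CMDiff ∞ (T% Y))
    (hZ : CMDiff ∞ (T% Z)) (hW : CMDiff ∞ (T% W)) (p : M) :
    (inner ℝ (curvatureField X Y Z p) (W p) : ℝ) = inner ℝ (curvatureField Z W X p) (Y p) := by
  have b (A B C D : Π x : M, TangentSpace I x) (hA : CMDiff ∞ (T% A)) (hB : CMDiff ∞ (T% B))
      (hC : CMDiff ∞ (T% C)) : (inner ℝ (curvatureField A B C p) (D p) : ℝ)
      + inner ℝ (curvatureField B C A p) (D p) + inner ℝ (curvatureField C A B p) (D p) = 0 := by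
    rw [← inner_add_left, ← inner_add_left, curvatureField_bianchi hA hB hC, inner_zero_left]
  have s (A B C D : Π x : M, TangentSpace I x) : (inner ℝ (curvatureField A B C p) (D p) : ℝ)
      = - inner ℝ (curvatureField B A C p) (D p) := by
    rw [curvatureField_swap, inner_neg_left]
  have b1 := b X Y Z W hX hY hZ
  have b2 := b Y Z W X hY hZ hW
  have b3 := b Z W X Y hZ hW hX
  have b4 := b W X Y Z hW hX hY
  have t1 := inner_curvatureField_skew hX hY hZ hW p
  have t2 := inner_curvatureField_skew hY hZ hX hW p
  have t3 := inner_curvatureField_skew hZ hX hY hW p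
  have t4 := inner_curvatureField_skew hZ hW hX hY p
  have t5 := inner_curvatureField_skew hW hX hY hZ p
  have t6 := inner_curvatureField_skew hY hW hX hZ p
  have s1 := s Z X Y W
  have s2 := s Y W X Z
  have s3 := s X Z W Y
  have s4 := s W Y Z X
  have t7 := inner_curvatureField_skew hX hZ hY hW p
  have t8 := inner_curvatureField_skew hW hY hX hZ p
  linarith

/-- The curvature depends only on the values of the fields at `p`: in the third argument by
skew-symmetry, in the first one by pair symmetry. -/
theorem curvatureField_congr {X' Y' Z' : Π x : M, TangentSpace I x} {p : M}
    (hX : CMDiff ∞ (T% X)) (hY : CMDiff ∞ (T% Y)) (hZ : CMDiff ∞ (T% Z))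
    (hX' : CMDiff ∞ (T% X')) (hY' : CMDiff ∞ (T% Y')) (hZ' : CMDiff ∞ (T% Z'))
    (h1 : X p = X' p) (h2 : Y p = Y' p) (h3 : Z p = Z' p) :
    curvatureField X Y Z p = curvatureField X' Y' Z' p := by
  have last (A B C C' : Π x : M, TangentSpace I x) (hA : CMDiff ∞ (T% A)) (hB : CMDiff ∞ (T% B))
      (hC : CMDiff ∞ (T% C)) (hC' : CMDiff ∞ (T% C')) (h : C p = C' p) :
      curvatureField A B C p = curvatureField A B C' p := by
    refine ext_inner_right ℝ fun w ↦ ?_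
    obtain ⟨D, hD, rfl⟩ := exists_contMDiff_apply_eq w
    rw [inner_curvatureField_skew hA hB hC hD, h, ← inner_curvatureField_skew hA hB hC' hD]
  have first (A A' B C : Π x : M, TangentSpace I x) (hA : CMDiff ∞ (T% A)) (hA' : CMDiff ∞ (T% A'))
      (hB : CMDiff ∞ (T% B)) (hC : CMDiff ∞ (T% C)) (h : A p = A' p) :
      curvatureField A B C p = curvatureField A' B C p := by
    refine ext_inner_right ℝ fun w ↦ ?_
    obtain ⟨D, hD, rfl⟩ := exists_contMDiff_apply_eq w
    rw [inner_curvatureField_pair hA hB hC hD, inner_curvatureField_pair hA' hB hC hD,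
      last _ _ _ _ hC hD hA hA' h]
  rw [first X X' Y Z hX hX' hY hZ h1, last X' Y Z Z' hX' hY hZ hZ' h3, ← neg_inj,
    ← curvatureField_swap, ← curvatureField_swap, first Y Y' X' Z' hY hY' hX' hZ' h2]

/-- The curvature tensor can be computed with arbitrary smooth vector fields. -/
theorem curvature_eq (hX : CMDiff ∞ (T% X)) (hY : CMDiff ∞ (T% Y)) (hZ : CMDiff ∞ (T% Z)) (p : M) :
    curvature p (X p) (Y p) (Z p) = curvatureField X Y Z p := by
  obtain ⟨X', hX', eX⟩ := exists_contMDiff_eq_extend (X p)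
  obtain ⟨Y', hY', eY⟩ := exists_contMDiff_eq_extend (Y p)
  obtain ⟨Z', hZ', eZ⟩ := exists_contMDiff_eq_extend (Z p)
  rw [curvatureField_congr hX hY hZ hX' hY' hZ' (by simp [eX.self_of_nhds])
    (by simp [eY.self_of_nhds]) (by simp [eZ.self_of_nhds])]
  have dext (v : TangentSpace I p) : ∀ᶠ q in nhds p, MDiffAt (T% (FiberBundle.extend E v)) q := by
    obtain ⟨s, hs, h⟩ := FiberBundle.exists_contMDiffOn_extend (k := ∞) I E
      (V := fun x : M ↦ TangentSpace I x) v
    filter_upwards [eventually_mem_nhds_iff.2 hs] with q hq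
    exact (h.contMDiffAt hq).mdifferentiableAt (by simp)
  have inn (U U' : Π x : M, TangentSpace I x) (hU' : CMDiff ∞ (T% U'))
      (hUU' : ∀ᶠ q in nhds p, U' q = U q) :
      ∀ᶠ q in nhds p, nabla U' Z' q = nabla U (FiberBundle.extend E (Z p)) q := by
    filter_upwards [hUU', dext (Z p), eZ.eventually_nhds] with q h1 h2 h3
    rw [nabla_congr_left h1, nabla_congr_right (mdiffAt_of_contMDiff hZ' q) h2 h3]
  have out (U U' V V' : Π x : M, TangentSpace I x) (hU' : CMDiff ∞ (T% U'))
      (hUU' : ∀ᶠ q in nhds p, U' q = U q) (hV' : CMDiff ∞ (T% V'))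
      (hVV' : ∀ᶠ q in nhds p, V' q = V q) :
      nabla V' (nabla U' Z') p = nabla V (nabla U (FiberBundle.extend E (Z p))) p := by
    have d := mdiffAt_of_contMDiff (contMDiff_nabla hU' hZ') p
    have i := inn U U' hU' hUU'
    rw [nabla_congr_left hVV'.self_of_nhds]
    refine nabla_congr_right d (d.congr_of_eventuallyEq ?_) i
    filter_upwards [i] with q hq
    simp [hq]
  rw [curvature, curvatureField_eq, curvatureField_eq, out _ _ _ _ hY' eY hX' eX,
    out _ _ _ _ hX' eX hY' eY]
  congr 1
  have hb : VectorField.mlieBracket I (FiberBundle.extend E (X p)) (FiberBundle.extend E (Y p)) p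
      = VectorField.mlieBracket I X' Y' p :=
    (Filter.EventuallyEq.mlieBracket_vectorField_eq eX eY).symm
  rw [nabla_congr_left hb,
    nabla_congr_right (mdiffAt_of_contMDiff hZ' p) (dext (Z p)).self_of_nhds eZ]

end LeviCivita

/-! ### The curvature tensor and the Ricci tensor at a point -/

section Ricci

variable {E : Type*} [NormedAddCommGroup E] [NormedSpace ℝ E] [FiniteDimensional ℝ E]
  {H : Type*} [TopologicalSpace H] {I : ModelWithCorners ℝ E H}
  {M : Type*} [TopologicalSpace M] [ChartedSpace H M] [IsManifold I ∞ M]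
  [RiemannianBundle (fun x : M ↦ TangentSpace I x)]
  [IsContMDiffRiemannianBundle I ∞ E (fun x : M ↦ TangentSpace I x)] [T2Space M]

theorem curvature_swap (p : M) (x y z : TangentSpace I p) :
    curvature p y x z = -curvature p x y z := by
  obtain ⟨X, hX, rfl⟩ := exists_contMDiff_apply_eq x
  obtain ⟨Y, hY, rfl⟩ := exists_contMDiff_apply_eq y
  obtain ⟨Z, hZ, rfl⟩ := exists_contMDiff_apply_eq z
  rw [curvature_eq hX hY hZ, curvature_eq hY hX hZ, curvatureField_swap]

theorem inner_curvature_skew (p : M) (x y z w : TangentSpace I p) :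
    (inner ℝ (curvature p x y z) w : ℝ) = -inner ℝ (curvature p x y w) z := by
  obtain ⟨X, hX, rfl⟩ := exists_contMDiff_apply_eq x
  obtain ⟨Y, hY, rfl⟩ := exists_contMDiff_apply_eq y
  obtain ⟨Z, hZ, rfl⟩ := exists_contMDiff_apply_eq z
  obtain ⟨W, hW, rfl⟩ := exists_contMDiff_apply_eq w
  rw [curvature_eq hX hY hZ, curvature_eq hX hY hW, inner_curvatureField_skew hX hY hZ hW]

theorem inner_curvature_pair (p : M) (x y z w : TangentSpace I p) :
    (inner ℝ (curvature p x y z) w : ℝ) = inner ℝ (curvature p z w x) y := by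
  obtain ⟨X, hX, rfl⟩ := exists_contMDiff_apply_eq x
  obtain ⟨Y, hY, rfl⟩ := exists_contMDiff_apply_eq y
  obtain ⟨Z, hZ, rfl⟩ := exists_contMDiff_apply_eq z
  obtain ⟨W, hW, rfl⟩ := exists_contMDiff_apply_eq w
  rw [curvature_eq hX hY hZ, curvature_eq hZ hW hX, inner_curvatureField_pair hX hY hZ hW]

theorem inner_curvature_eq_neg_inner_left (p : M) (x y z w : TangentSpace I p) :
    (inner ℝ (curvature p x y z) w : ℝ) = -inner ℝ x (curvature p z w y) := by
  rw [inner_curvature_pair, inner_curvature_skew, real_inner_comm]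

/-- The endomorphism `x ↦ R(x, y) z` of the tangent space. -/
noncomputable def curvatureEnd (p : M) (y z : TangentSpace I p) :
    TangentSpace I p →ₗ[ℝ] TangentSpace I p where
  toFun x := curvature p x y z
  map_add' a b := by
    refine ext_inner_right ℝ fun w ↦ ?_
    rw [inner_add_left]
    simp only [inner_curvature_eq_neg_inner_left _ _ y z w]
    rw [inner_add_left]
    ring
  map_smul' c a := by
    refine ext_inner_right ℝ fun w ↦ ?_
    rw [RingHom.id_apply, real_inner_smul_left]
    simp only [inner_curvature_eq_neg_inner_left _ _ y z w]
    rw [real_inner_smul_left]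
    ring

/-- The Ricci tensor can be computed in any orthonormal basis. -/
theorem ricci_eq_sum {ι : Type*} [Fintype ι] {p : M}
    (b : OrthonormalBasis ι ℝ (TangentSpace I p)) (y z : TangentSpace I p) :
    ricci p y z = ∑ i, inner ℝ (curvature p (b i) y z) (b i) := by
  have h1 := (curvatureEnd p y z).trace_eq_sum_inner b
  have h2 := (curvatureEnd p y z).trace_eq_sum_inner (stdOrthonormalBasis ℝ (TangentSpace I p))
  simp only [real_inner_comm (curvatureEnd p y z _)] at h1 h2
  exact h2.symm.trans h1

theorem ricci_symm (p : M) (y z : TangentSpace I p) : ricci p y z = ricci p z y := by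
  refine Finset.sum_congr rfl fun i _ ↦ ?_
  rw [inner_curvature_pair, inner_curvature_skew, curvature_swap, inner_neg_left]
  ring

theorem ricci_add_right (p : M) (y z w : TangentSpace I p) :
    ricci p y (z + w) = ricci p y z + ricci p y w := by
  simp only [ricci, ← Finset.sum_add_distrib]
  refine Finset.sum_congr rfl fun i _ ↦ ?_
  rw [inner_curvature_skew, inner_add_right, inner_curvature_skew p _ y z,
    inner_curvature_skew p _ y w]
  ring

theorem ricci_smul_right (p : M) (c : ℝ) (y z : TangentSpace I p) :
    ricci p y (c • z) = c * ricci p y z := by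
  simp only [ricci, Finset.mul_sum]
  refine Finset.sum_congr rfl fun i _ ↦ ?_
  rw [inner_curvature_skew, real_inner_smul_right, inner_curvature_skew p _ y z]
  ring

theorem ricci_add_left (p : M) (y z w : TangentSpace I p) :
    ricci p (y + z) w = ricci p y w + ricci p z w := by
  rw [ricci_symm, ricci_add_right, ricci_symm p w, ricci_symm p w]

theorem ricci_smul_left (p : M) (c : ℝ) (y z : TangentSpace I p) :
    ricci p (c • y) z = c * ricci p y z := by
  rw [ricci_symm, ricci_smul_right, ricci_symm p z]

end Ricci

/-! ### Smooth tensor fields applied to vector fields -/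

section Endomorphisms

variable {E : Type*} [NormedAddCommGroup E] [NormedSpace ℝ E]
  {H : Type*} [TopologicalSpace H] {I : ModelWithCorners ℝ E H}
  {M : Type*} [TopologicalSpace M] [ChartedSpace H M] [IsManifold I ∞ M]

/-- `X` is a smooth vector field. -/
abbrev SmoothField (X : Π x : M, TangentSpace I x) : Prop :=
  ContMDiff I I.tangent ∞ (fun x ↦ (⟨x, X x⟩ : TangentBundle I M))

theorem SmoothEnd.contMDiff_apply {φ : Π x : M, TangentSpace I x →L[ℝ] TangentSpace I x}
    (hφ : SmoothEnd φ) {X : Π x : M, TangentSpace I x} (hX : CMDiff ∞ (T% X)) :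
    CMDiff ∞ (T% (fun q ↦ φ q (X q))) :=
  ContMDiff.clm_bundle_apply (F₁ := E) (F₂ := E) (E₁ := fun x : M ↦ TangentSpace I x)
    (E₂ := fun x : M ↦ TangentSpace I x) hφ hX

theorem SmoothEnd.mdifferentiableAt_apply
    {φ : Π x : M, TangentSpace I x →L[ℝ] TangentSpace I x}
    (hφ : SmoothEnd φ) {X : Π x : M, TangentSpace I x} {p : M} (hX : MDiffAt (T% X) p) :
    MDiffAt (T% (fun q ↦ φ q (X q))) p :=
  MDifferentiableAt.clm_bundle_apply (F₁ := E) (F₂ := E) (E₁ := fun x : M ↦ TangentSpace I x)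
    (E₂ := fun x : M ↦ TangentSpace I x) ((hφ p).mdifferentiableAt (by simp)) hX

theorem SmoothForm.contMDiff_apply {η : Π x : M, TangentSpace I x →L[ℝ] ℝ}
    (hη : SmoothForm η) {X : Π x : M, TangentSpace I x} (hX : CMDiff ∞ (T% X)) :
    CMDiff ∞ (fun q ↦ η q (X q)) := by
  have h : ContMDiff I (I.prod 𝓘(ℝ, ℝ)) ∞
      (fun q ↦ TotalSpace.mk' ℝ (E := Bundle.Trivial M ℝ) q (η q (X q))) :=
    ContMDiff.clm_bundle_apply (F₁ := E) (F₂ := ℝ) (E₁ := fun x : M ↦ TangentSpace I x)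
      (E₂ := Bundle.Trivial M ℝ) hη hX
  intro q
  exact (contMDiffAt_totalSpace.1 (h q)).2

variable [FiniteDimensional ℝ E] [RiemannianBundle (fun x : M ↦ TangentSpace I x)]
  [IsContMDiffRiemannianBundle I ∞ E (fun x : M ↦ TangentSpace I x)]

/-- `(∇_X φ) Y = ∇_X (φ Y) - φ (∇_X Y)` for arbitrary smooth fields. -/
theorem nablaEnd_eq {φ : Π x : M, TangentSpace I x →L[ℝ] TangentSpace I x} (hφ : SmoothEnd φ)
    {X Y : Π x : M, TangentSpace I x} (hY : CMDiff ∞ (T% Y)) (p : M) :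
    nablaEnd φ p (X p) (Y p) = nabla X (fun q ↦ φ q (Y q)) p - φ p (nabla X Y p) := by
  let Φ : (Π x : M, TangentSpace I x) → TangentSpace I p := fun Z ↦
    leviCivita I M (fun q ↦ φ q (Z q)) p (X p) - φ p (leviCivita I M Z p (X p))
  have hD := (leviCivita I M).isCovariantDerivativeOn (s := Set.univ)
  have hΦ : TensorialAt I E Φ p :=
    { smul := by
        intro f Z hf hZ
        have e : (fun q ↦ φ q ((f • Z) q)) = f • fun q ↦ φ q (Z q) := by
          funext q; simp
        simp only [Φ]
        rw [e, hD.leibniz hZ hf (Set.mem_univ p),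
          hD.leibniz (hφ.mdifferentiableAt_apply hZ) hf (Set.mem_univ p)]
        simp [smul_sub]
      add := by
        intro Z Z' hZ hZ'
        have e : (fun q ↦ φ q ((Z + Z') q)) = (fun q ↦ φ q (Z q)) + fun q ↦ φ q (Z' q) := by
          funext q; simp
        simp only [Φ]
        rw [e, hD.add hZ hZ' (Set.mem_univ p), hD.add (hφ.mdifferentiableAt_apply hZ)
          (hφ.mdifferentiableAt_apply hZ') (Set.mem_univ p)]
        simp
        abel }
  exact hΦ.pointwise (FiberBundle.mdifferentiableAt_extend ..) (mdiffAt_of_contMDiff hY p)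
    (by simp)

end Endomorphisms

/-! ### Connection and curvature of a para-Sasaki-like manifold -/

section Paracontact

variable {n : ℕ} {M : Type u} [TopologicalSpace M]
  [ChartedSpace (EuclideanSpace ℝ (Fin (2 * n + 1))) M] [IsManifold (𝓡 (2 * n + 1)) ∞ M]
  [RiemannianBundle (fun x : M ↦ TangentSpace (𝓡 (2 * n + 1)) x)]

namespace ApcpcR

variable (S : ApcpcR n M)

theorem phi_xi (p : M) : S.φ p (S.ξ p) = 0 := by
  have h := S.inner_phi p (S.ξ p) (S.ξ p)
  rw [S.inner_xi, S.eta_xi, mul_one, sub_self] at h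
  exact inner_self_eq_zero.1 h

theorem eta_phi (p : M) (v : TangentSpace (𝓡 (2 * n + 1)) p) : S.η p (S.φ p v) = 0 := by
  have h := S.sq_phi p (S.φ p v)
  rw [S.sq_phi p v, map_sub, map_smul, S.phi_xi, smul_zero, sub_zero] at h
  have h2 := congrArg (S.η p) h
  rw [map_sub, map_smul, S.eta_xi, smul_eq_mul, mul_one] at h2
  linarith

theorem inner_phi_left (p : M) (v w : TangentSpace (𝓡 (2 * n + 1)) p) :
    (inner ℝ (S.φ p v) w : ℝ) = inner ℝ v (S.φ p w) := by
  have h := S.inner_phi p v (S.φ p w)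
  rw [S.sq_phi, S.eta_phi, inner_sub_right, real_inner_smul_right, S.inner_xi, S.eta_phi] at h
  linarith

theorem phi_phi_of_eta_eq_zero {p : M} {v : TangentSpace (𝓡 (2 * n + 1)) p} (h : S.η p v = 0) :
    S.φ p (S.φ p v) = v := by
  rw [S.sq_phi, h, zero_smul, sub_zero]

theorem eta_sub (p : M) (v : TangentSpace (𝓡 (2 * n + 1)) p) :
    S.η p (v - S.η p v • S.ξ p) = 0 := by
  rw [map_sub, map_smul, S.eta_xi, smul_eq_mul, mul_one, sub_self]

variable [IsContMDiffRiemannianBundle (𝓡 (2 * n + 1)) ∞ (EuclideanSpace ℝ (Fin (2 * n + 1)))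
    (fun x : M ↦ TangentSpace (𝓡 (2 * n + 1)) x)]

variable {S}
variable {X Y Z : Π x : M, TangentSpace (𝓡 (2 * n + 1)) x}

theorem F_eq (hY : SmoothField Y) (p : M) (w : TangentSpace (𝓡 (2 * n + 1)) p) :
    S.F p (X p) (Y p) w
      = inner ℝ (nabla X (fun q ↦ S.φ q (Y q)) p) w - inner ℝ (S.φ p (nabla X Y p)) w := by
  rw [ApcpcR.F, nablaEnd_eq S.smooth_phi hY, inner_sub_left]

theorem inner_nabla_xi_xi (p : M) :
    (inner ℝ (nabla X S.ξ p) (S.ξ p) : ℝ) = 0 := by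
  have h := mvfderiv_inner (X := X) S.smooth_xi S.smooth_xi p
  have e : (fun q ↦ (inner ℝ (S.ξ q) (S.ξ q) : ℝ)) = fun _ ↦ 1 := by
    funext q; rw [S.inner_xi, S.eta_xi]
  rw [e, mvfderiv_const, real_inner_comm (nabla X S.ξ p)] at h
  simp at h
  linarith

theorem inner_nabla_xi (hY : SmoothField Y) (hη : ∀ q, S.η q (Y q) = 0) (p : M) :
    (inner ℝ (nabla X Y p) (S.ξ p) : ℝ) = -inner ℝ (Y p) (nabla X S.ξ p) := by
  have h := mvfderiv_inner (X := X) hY S.smooth_xi p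
  have e : (fun q ↦ (inner ℝ (Y q) (S.ξ q) : ℝ)) = fun _ ↦ 0 := by
    funext q; rw [S.inner_xi, hη]
  rw [e, mvfderiv_const] at h
  simp at h
  linarith

namespace IsParaSasakiLike

variable [T2Space M] (hS : S.IsParaSasakiLike)
include hS

/-- `∇_x ξ = φ x`. -/
theorem nabla_xi (X : Π x : M, TangentSpace (𝓡 (2 * n + 1)) x) (p : M) :
    nabla X S.ξ p = S.φ p (X p) := by
  -- for horizontal `x`, the condition on `F(x, φ y, ξ)` gives the scalar products with horizontal `y`
  have hor (x : TangentSpace (𝓡 (2 * n + 1)) p) (hx : S.η p x = 0) :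
      leviCivita (𝓡 (2 * n + 1)) M S.ξ p x = S.φ p x := by
    obtain ⟨X, hX, rfl⟩ := exists_contMDiff_apply_eq x
    change nabla X S.ξ p = _
    have key (y : TangentSpace (𝓡 (2 * n + 1)) p) (hy : S.η p y = 0) :
        (inner ℝ y (nabla X S.ξ p) : ℝ) = inner ℝ y (S.φ p (X p)) := by
      obtain ⟨Y, hY, hYp⟩ := exists_contMDiff_apply_eq (S.φ p y)
      have h1 := hS.hor_xi p (X p) (Y p) hx (by rw [hYp, S.eta_phi])
      rw [F_eq hY, inner_phi_left, S.phi_xi, inner_zero_right, sub_zero,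
        inner_nabla_xi (S.smooth_phi.contMDiff_apply hY) (fun q ↦ S.eta_phi q _), hYp,
        S.phi_phi_of_eta_eq_zero hy] at h1
      rw [← inner_phi_left, real_inner_comm (X p) (S.φ p y)]
      linarith
    refine ext_inner_left ℝ fun w ↦ ?_
    have hw : w = (w - S.η p w • S.ξ p) + S.η p w • S.ξ p := by abel
    rw [hw, inner_add_left, inner_add_left, key _ (S.eta_sub p w), real_inner_smul_left,
      real_inner_smul_left, real_inner_comm (nabla X S.ξ p) (S.ξ p), inner_nabla_xi_xi,
      ← inner_phi_left S p (S.ξ p),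
      S.phi_xi, inner_zero_left]
  -- `∇_ξ ξ = 0` follows from `F(ξ, ξ, φ y) = 0` and `φ ξ = 0`
  have ver : leviCivita (𝓡 (2 * n + 1)) M S.ξ p (S.ξ p) = 0 := by
    change nabla S.ξ S.ξ p = 0
    have key (y : TangentSpace (𝓡 (2 * n + 1)) p) (hy : S.η p y = 0) :
        (inner ℝ y (nabla S.ξ S.ξ p) : ℝ) = 0 := by
      have h1 := hS.omega p (S.φ p y) (S.eta_phi p y)
      rw [F_eq S.smooth_xi, inner_phi_left, S.phi_phi_of_eta_eq_zero hy] at h1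
      have e : (fun q ↦ S.φ q (S.ξ q)) = 0 := by funext q; exact S.phi_xi q
      have e2 : nabla S.ξ (0 : Π x : M, TangentSpace (𝓡 (2 * n + 1)) x) p = 0 := by
        have := (leviCivita (𝓡 (2 * n + 1)) M).zero
        simp only [nabla, this]; rfl
      rw [e, e2, inner_zero_left, real_inner_comm] at h1
      linarith
    refine ext_inner_left ℝ fun w ↦ ?_
    have hw : w = (w - S.η p w • S.ξ p) + S.η p w • S.ξ p := by abel
    rw [hw, inner_add_left, key _ (S.eta_sub p w), real_inner_smul_left,
      real_inner_comm, inner_nabla_xi_xi, inner_zero_right, mul_zero, add_zero]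
  have hx : X p = (X p - S.η p (X p) • S.ξ p) + S.η p (X p) • S.ξ p := by abel
  rw [nabla, hx, map_add, map_smul, ver, hor _ (S.eta_sub p _), map_add, map_smul, S.phi_xi]

/-- The vertical part of `∇_X Y` for horizontal `Y` is `-g(φ X, Y) ξ`. -/
theorem inner_nabla_eq (hY : SmoothField Y) (hη : ∀ q, S.η q (Y q) = 0) (p : M) :
    (inner ℝ (nabla X Y p) (S.ξ p) : ℝ) = -inner ℝ (S.φ p (X p)) (Y p) := by
  rw [inner_nabla_xi hY hη, hS.nabla_xi, real_inner_comm]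

/-- `(∇_x φ) y = -g(x, y) ξ - η(y) x + 2 η(x) η(y) ξ`. -/
theorem nablaEnd_phi (p : M) (x y : TangentSpace (𝓡 (2 * n + 1)) p) :
    nablaEnd S.φ p x y
      = (2 * S.η p x * S.η p y - inner ℝ x y) • S.ξ p - S.η p y • x := by
  have hor (y : TangentSpace (𝓡 (2 * n + 1)) p) (hy : S.η p y = 0) :
      nablaEnd S.φ p x y = -(inner ℝ x y : ℝ) • S.ξ p := by
    have key (w : TangentSpace (𝓡 (2 * n + 1)) p) (hw : S.η p w = 0) :
        (inner ℝ (nablaEnd S.φ p x y) w : ℝ) = 0 := by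
      have h1 := hS.hor p (x - S.η p x • S.ξ p) y w (S.eta_sub p x) hy hw
      have h2 := hS.xi_hor p y w hy hw
      have e : nablaEnd S.φ p x y = nablaEnd S.φ p (x - S.η p x • S.ξ p) y
          + S.η p x • nablaEnd S.φ p (S.ξ p) y := by
        simp only [nablaEnd, map_sub, map_smul]
        module
      rw [ApcpcR.F] at h1 h2
      rw [e, inner_add_left, real_inner_smul_left, h1, h2, mul_zero, add_zero]
    have key2 : (inner ℝ (nablaEnd S.φ p x y) (S.ξ p) : ℝ) = -inner ℝ x y := by
      obtain ⟨X, hX, rfl⟩ := exists_contMDiff_apply_eq x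
      obtain ⟨Y, hY, rfl⟩ := exists_contMDiff_apply_eq y
      rw [nablaEnd_eq S.smooth_phi hY, inner_sub_left, inner_phi_left, S.phi_xi, inner_zero_right,
        sub_zero, hS.inner_nabla_eq (S.smooth_phi.contMDiff_apply hY) (fun q ↦ S.eta_phi q _),
        S.inner_phi, hy, mul_zero, sub_zero]
    refine ext_inner_right ℝ fun w ↦ ?_
    have hw : w = (w - S.η p w • S.ξ p) + S.η p w • S.ξ p := by abel
    rw [hw, inner_add_right, inner_add_right, key _ (S.eta_sub p w), real_inner_smul_right, key2,
      real_inner_smul_left, real_inner_smul_left, real_inner_smul_right,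
      real_inner_comm (w - S.η p w • S.ξ p), S.inner_xi, S.eta_sub, S.inner_xi, S.eta_xi]
    ring
  obtain ⟨X, hX, rfl⟩ := exists_contMDiff_apply_eq x
  -- the vertical part of `y` is extended with a constant coefficient `c`
  obtain ⟨Y, hY, hYp⟩ := exists_contMDiff_apply_eq (y - S.η p y • S.ξ p)
  let c : M → ℝ := fun _ ↦ S.η p y
  have hc : ContMDiff (𝓡 (2 * n + 1)) 𝓘(ℝ, ℝ) ∞ c := contMDiff_const
  have hcξ : SmoothField (c • S.ξ) := hc.smul_section S.smooth_xi
  have hY' : SmoothField (Y + c • S.ξ) := hY.add_section hcξ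
  have hyp : (Y + c • S.ξ) p = y := by simp [hYp, c]
  have e : (fun q ↦ S.φ q ((Y + c • S.ξ) q)) = fun q ↦ S.φ q (Y q) := by
    funext q
    simp [S.phi_xi]
  have h1 := nablaEnd_eq (X := X) S.smooth_phi hY' p
  have h2 := nablaEnd_eq (X := X) S.smooth_phi hY p
  rw [e, nabla_add_right hY hcξ, nabla_smul_right hc S.smooth_xi, mvfderiv_const, hS.nabla_xi,
    hyp] at h1
  rw [hYp, hor _ (S.eta_sub p y), inner_sub_right, real_inner_smul_right, S.inner_xi] at h2
  rw [h1, map_add, ← sub_sub, ← h2]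
  simp only [zero_apply, zero_smul, zero_add, map_smul, c, S.sq_phi]
  module

/-- `R(x, y) ξ = η(x) y - η(y) x`. -/
theorem curvature_xi (p : M) (x y : TangentSpace (𝓡 (2 * n + 1)) p) :
    curvature p x y (S.ξ p) = S.η p x • y - S.η p y • x := by
  obtain ⟨X, hX, rfl⟩ := exists_contMDiff_apply_eq x
  obtain ⟨Y, hY, rfl⟩ := exists_contMDiff_apply_eq y
  have e (Z : Π x : M, TangentSpace (𝓡 (2 * n + 1)) x) :
      nabla Z S.ξ = fun q ↦ S.φ q (Z q) := by funext q; exact hS.nabla_xi Z q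
  rw [curvature_eq hX hY S.smooth_xi, curvatureField_eq, e, e, e]
  dsimp only
  rw [← nabla_sub_nabla_swap hX hY, map_sub]
  have h1 := nablaEnd_eq (X := X) S.smooth_phi hY p
  have h2 := nablaEnd_eq (X := Y) S.smooth_phi hX p
  rw [hS.nablaEnd_phi] at h1 h2
  have h3 : nabla X (fun q ↦ S.φ q (Y q)) p - nabla Y (fun q ↦ S.φ q (X q)) p
      - (S.φ p (nabla X Y p) - S.φ p (nabla Y X p))
      = (nabla X (fun q ↦ S.φ q (Y q)) p - S.φ p (nabla X Y p))
        - (nabla Y (fun q ↦ S.φ q (X q)) p - S.φ p (nabla Y X p)) := by abel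
  rw [h3, ← h1, ← h2, real_inner_comm]
  module

theorem ricci_xi (p : M) (y : TangentSpace (𝓡 (2 * n + 1)) p) :
    ricci p y (S.ξ p) = -2 * n * inner ℝ y (S.ξ p) := by
  let b := stdOrthonormalBasis ℝ (TangentSpace (𝓡 (2 * n + 1)) p)
  have h1 (i) : (inner ℝ (curvature p (b i) y (S.ξ p)) (b i) : ℝ)
      = inner ℝ y (b i) * inner ℝ (b i) (S.ξ p) - S.η p y := by
    have hb : (inner ℝ (b i) (b i) : ℝ) = 1 := by
      rw [real_inner_self_eq_norm_sq, b.norm_eq_one, one_pow]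
    rw [hS.curvature_xi, inner_sub_left, real_inner_smul_left, real_inner_smul_left, hb,
      ← S.inner_xi]
    ring
  rw [ricci_eq_sum b]
  simp only [h1]
  have hfr : Module.finrank ℝ (TangentSpace (𝓡 (2 * n + 1)) p) = 2 * n + 1 :=
    finrank_euclideanSpace_fin
  rw [Finset.sum_sub_distrib, b.sum_inner_mul_inner]
  simp [hfr, S.inner_xi]
  ring

end IsParaSasakiLike
end ApcpcR
end Paracontact

/-! ### Vector fields related by a smooth map -/

section RelatedFields

variable {E : Type*} [NormedAddCommGroup E] [NormedSpace ℝ E] [FiniteDimensional ℝ E]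
  {H : Type*} [TopologicalSpace H] {I : ModelWithCorners ℝ E H}
  {M : Type*} [TopologicalSpace M] [ChartedSpace H M] [IsManifold I ∞ M]
  {E' : Type*} [NormedAddCommGroup E'] [NormedSpace ℝ E'] [FiniteDimensional ℝ E']
  {H' : Type*} [TopologicalSpace H'] {I' : ModelWithCorners ℝ E' H'}
  {M' : Type*} [TopologicalSpace M'] [ChartedSpace H' M'] [IsManifold I' ∞ M']

/-- Smooth functions separate tangent vectors. -/
theorem tangentVector_ext [T2Space M] {p : M} {v w : TangentSpace I p}
    (h : ∀ g : M → ℝ, ContMDiff I 𝓘(ℝ, ℝ) ∞ g → mvfderiv I g p v = mvfderiv I g p w) : v = w := by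
  have hinv := isInvertible_mfderiv_extChartAt (I := I) (mem_extChartAt_source (I := I) p)
  refine hinv.injective ?_
  refine (SeparatingDual.eq_iff_forall_dual_eq (R := ℝ) (V := E)).2 fun L ↦ ?_
  have hs : (extChartAt I p).source ∈ nhds p := extChartAt_source_mem_nhds p
  have hL : ContMDiffOn I 𝓘(ℝ, ℝ) ∞ (L ∘ extChartAt I p) (extChartAt I p).source := by
    rw [extChartAt_source]
    exact L.contMDiff.comp_contMDiffOn contMDiffOn_extChartAt
  obtain ⟨g, hg, hge⟩ := exists_contMDiff_function_eventuallyEq hs hL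
  have hd : mfderiv I 𝓘(ℝ, ℝ) g p
      = (mfderiv 𝓘(ℝ, E) 𝓘(ℝ, ℝ) L (extChartAt I p p)).comp
        (mfderiv I 𝓘(ℝ, E) (extChartAt I p) p) := by
    rw [Filter.EventuallyEq.mfderiv_eq hge]
    exact mfderiv_comp p L.differentiableAt.mdifferentiableAt
      (mdifferentiableAt_extChartAt (mem_chart_source H p))
  have hL' : mfderiv 𝓘(ℝ, E) 𝓘(ℝ, ℝ) L (extChartAt I p p) = L := by
    rw [mfderiv_eq_fderiv]; exact L.fderiv
  have := h g hg
  change mfderiv I 𝓘(ℝ, ℝ) g p v = mfderiv I 𝓘(ℝ, ℝ) g p w at this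
  rw [hd, hL'] at this
  exact this

/-- Lie brackets of related vector fields are related. -/
theorem mfderiv_mlieBracket_of_related [T2Space M] [T2Space M'] {f : M → M'}
    (hf : ContMDiff I I' ∞ f) {X Y : Π x : M, TangentSpace I x}
    {X' Y' : Π x : M', TangentSpace I' x} (hX : SmoothField X) (hY : SmoothField Y)
    (hX' : SmoothField X') (hY' : SmoothField Y') (hXX' : ∀ p, mfderiv I I' f p (X p) = X' (f p))
    (hYY' : ∀ p, mfderiv I I' f p (Y p) = Y' (f p)) (p : M) :
    mfderiv I I' f p (VectorField.mlieBracket I X Y p) = VectorField.mlieBracket I' X' Y' (f p) := by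
  refine tangentVector_ext fun g hg ↦ ?_
  have chain (g : M' → ℝ) (hg : ContMDiff I' 𝓘(ℝ, ℝ) ∞ g) (q : M) (v : TangentSpace I q) :
      mvfderiv I' g (f q) (mfderiv I I' f q v) = mvfderiv I (g ∘ f) q v :=
    (mvfderiv_comp_apply q ((hg (f q)).mdifferentiableAt (by simp))
      ((hf q).mdifferentiableAt (by simp)) v).symm
  have hgX' : ContMDiff I' 𝓘(ℝ, ℝ) ∞ (fun q ↦ mvfderiv I' g q (X' q)) := fun q ↦
    contMDiffAt_mvfderiv_apply (hg q) (hX' q)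
  have hgY' : ContMDiff I' 𝓘(ℝ, ℝ) ∞ (fun q ↦ mvfderiv I' g q (Y' q)) := fun q ↦
    contMDiffAt_mvfderiv_apply (hg q) (hY' q)
  have eX : (fun q ↦ mvfderiv I (g ∘ f) q (X q)) = (fun q ↦ mvfderiv I' g q (X' q)) ∘ f := by
    funext q
    rw [← chain g hg, hXX']; rfl
  have eY : (fun q ↦ mvfderiv I (g ∘ f) q (Y q)) = (fun q ↦ mvfderiv I' g q (Y' q)) ∘ f := by
    funext q
    rw [← chain g hg, hYY']; rfl
  rw [chain g hg, mvfderiv_mlieBracket hX hY (hg.comp hf), mvfderiv_mlieBracket hX' hY' hg, eX, eY,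
    ← chain _ hgX', ← chain _ hgY', hXX', hYY']

end RelatedFields

/-! ### Traces of involutions -/

section Trace

/-- An involution whose eigenspaces have equal dimensions is trace-free. -/
theorem trace_eq_zero_of_involution {V : Type*} [AddCommGroup V] [Module ℝ V]
    [FiniteDimensional ℝ V] {P : V →ₗ[ℝ] V} (hP : ∀ v, P (P v) = v)
    (h : Module.finrank ℝ (Module.End.eigenspace P (1 : ℝ))
      = Module.finrank ℝ (Module.End.eigenspace P (-1 : ℝ))) :
    LinearMap.trace ℝ V P = 0 := by
  have h1 : LinearMap.IsProj (Module.End.eigenspace P (1 : ℝ))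
      ((1 / 2 : ℝ) • (LinearMap.id + P)) :=
    { map_mem := fun v ↦ by
        rw [Module.End.mem_eigenspace_iff]
        simp [hP, add_comm]
      map_id := fun v hv ↦ by
        rw [Module.End.mem_eigenspace_iff] at hv
        simp only [LinearMap.smul_apply, LinearMap.add_apply, LinearMap.id_apply, hv]
        module }
  have h2 : LinearMap.IsProj (Module.End.eigenspace P (-1 : ℝ))
      ((1 / 2 : ℝ) • (LinearMap.id - P)) :=
    { map_mem := fun v ↦ by
        rw [Module.End.mem_eigenspace_iff]
        simp only [LinearMap.smul_apply, LinearMap.sub_apply, LinearMap.id_apply, map_smul,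
          map_sub, hP]
        module
      map_id := fun v hv ↦ by
        rw [Module.End.mem_eigenspace_iff] at hv
        simp only [LinearMap.smul_apply, LinearMap.sub_apply, LinearMap.id_apply, hv]
        module }
  have e : P = (1 / 2 : ℝ) • (LinearMap.id + P) - (1 / 2 : ℝ) • (LinearMap.id - P) := by module
  rw [e, map_sub, h1.trace, h2.trace, h, sub_self]

end Trace

/-! ### Horizontal vector fields and integral manifolds -/

section IntegralManifolds

variable {n : ℕ} {M : Type u} [TopologicalSpace M]
  [ChartedSpace (EuclideanSpace ℝ (Fin (2 * n + 1))) M] [IsManifold (𝓡 (2 * n + 1)) ∞ M]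
  [RiemannianBundle (fun x : M ↦ TangentSpace (𝓡 (2 * n + 1)) x)]
  {S : ApcpcR n M} (N : IntegralManifold S)

namespace IntegralManifold

/-- The differential of the inclusion of an integral manifold. -/
noncomputable abbrev dincl (p : N.carrier) :
    TangentSpace (𝓡 (2 * n)) p →L[ℝ] TangentSpace (𝓡 (2 * n + 1)) (N.incl p) :=
  mfderiv (𝓡 (2 * n)) (𝓡 (2 * n + 1)) N.incl p

theorem dincl_injective (p : N.carrier) : Function.Injective (N.dincl p) := by
  refine (injective_iff_map_eq_zero _).2 fun u hu ↦ ?_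
  have h := N.inner_eq p u u
  rw [hu, inner_zero_left] at h
  exact inner_self_eq_zero.1 h

theorem eta_dincl (p : N.carrier) (u : TangentSpace (𝓡 (2 * n)) p) :
    S.η (N.incl p) (N.dincl p u) = 0 := by
  have h : N.dincl p u ∈ (S.η (N.incl p)).ker := by
    rw [← N.range_mfderiv p]; exact ⟨u, rfl⟩
  exact h

theorem exists_dincl_eq {p : N.carrier} {v : TangentSpace (𝓡 (2 * n + 1)) (N.incl p)}
    (hv : S.η (N.incl p) v = 0) : ∃ u, N.dincl p u = v := by
  have h : v ∈ (mfderiv (𝓡 (2 * n)) (𝓡 (2 * n + 1)) N.incl p).range := by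
    rw [N.range_mfderiv p]; exact hv
  exact h

/-- The smooth field `X` on `N` is the restriction of the smooth horizontal field `X'` on `M`. -/
structure Related (X : Π p : N.carrier, TangentSpace (𝓡 (2 * n)) p)
    (X' : Π x : M, TangentSpace (𝓡 (2 * n + 1)) x) : Prop where
  smooth_left : SmoothField X
  smooth_right : SmoothField X'
  eta_eq_zero : ∀ q, S.η q (X' q) = 0
  dincl_eq : ∀ p, N.dincl p (X p) = X' (N.incl p)

theorem contMDiff_dincl_apply {X : Π p : N.carrier, TangentSpace (𝓡 (2 * n)) p}
    (hX : SmoothField X) : ContMDiff (𝓡 (2 * n)) (𝓡 (2 * n + 1)).tangent ∞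
      (fun q ↦ (⟨N.incl q, N.dincl q (X q)⟩ : TangentBundle (𝓡 (2 * n + 1)) M)) :=
  fun q ↦ contMDiffAt_mfderiv_apply (N.contMDiff_incl q) (hX q)

variable [IsContMDiffRiemannianBundle (𝓡 (2 * n + 1)) ∞ (EuclideanSpace ℝ (Fin (2 * n + 1)))
    (fun x : M ↦ TangentSpace (𝓡 (2 * n + 1)) x)]

/-- A horizontal field restricts to `N`. -/
theorem exists_related_of_eta_eq_zero {X' : Π x : M, TangentSpace (𝓡 (2 * n + 1)) x}
    (hX' : SmoothField X') (h : ∀ q, S.η q (X' q) = 0) : ∃ X, N.Related X X' := by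
  choose X hX using fun p : N.carrier ↦ N.exists_dincl_eq (h (N.incl p))
  refine ⟨X, contMDiff_of_inner fun W hW ↦ ?_, hX', h, hX⟩
  have e : (fun q ↦ (inner ℝ (X q) (W q) : ℝ))
      = fun q ↦ inner ℝ (X' (N.incl q)) (N.dincl q (W q)) := by
    funext q; rw [N.inner_eq, ← hX]
  rw [e]
  exact ContMDiff.inner_bundle (E := fun x : M ↦ TangentSpace (𝓡 (2 * n + 1)) x)
    (F := EuclideanSpace ℝ (Fin (2 * n + 1))) (hX'.comp N.contMDiff_incl)
    (N.contMDiff_dincl_apply hW)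

/-- Every tangent vector of `N` extends to a field on `N` that is the restriction of a horizontal
field on `M`: project an extension to `M` to `ker η`. -/
theorem exists_related [T2Space M] {p : N.carrier} (u : TangentSpace (𝓡 (2 * n)) p) :
    ∃ X X', N.Related X X' ∧ X p = u := by
  obtain ⟨A, hA, hAp⟩ := exists_contMDiff_apply_eq (N.dincl p u)
  obtain ⟨X, hX⟩ := N.exists_related_of_eta_eq_zero
    (hA.sub_section ((S.smooth_eta.contMDiff_apply hA).smul_section S.smooth_xi))
    (fun q ↦ S.eta_sub q (A q))
  refine ⟨X, _, hX, N.dincl_injective p ?_⟩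
  rw [hX.dincl_eq]
  simp [hAp, N.eta_dincl]

end IntegralManifold
end IntegralManifolds

/-! ### The Gauss formula and the paracomplex structure -/

section IntegralManifoldGeometry

variable {n : ℕ} {M : Type u} [TopologicalSpace M] [T2Space M]
  [ChartedSpace (EuclideanSpace ℝ (Fin (2 * n + 1))) M] [IsManifold (𝓡 (2 * n + 1)) ∞ M]
  [RiemannianBundle (fun x : M ↦ TangentSpace (𝓡 (2 * n + 1)) x)]
  [IsContMDiffRiemannianBundle (𝓡 (2 * n + 1)) ∞ (EuclideanSpace ℝ (Fin (2 * n + 1)))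
    (fun x : M ↦ TangentSpace (𝓡 (2 * n + 1)) x)]
  {S : ApcpcR n M}

namespace IntegralManifold

variable {N : IntegralManifold S}
  {X Y Z W : Π p : N.carrier, TangentSpace (𝓡 (2 * n)) p}
  {X' Y' Z' W' : Π x : M, TangentSpace (𝓡 (2 * n + 1)) x}

theorem inner_eq_of_related (hX : N.Related X X') (hY : N.Related Y Y') (p : N.carrier) :
    (inner ℝ (X p) (Y p) : ℝ) = inner ℝ (X' (N.incl p)) (Y' (N.incl p)) := by
  rw [N.inner_eq, hX.dincl_eq, hY.dincl_eq]

theorem mvfderiv_comp_incl {f : M → ℝ} (hf : ContMDiff (𝓡 (2 * n + 1)) 𝓘(ℝ, ℝ) ∞ f)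
    (hX : N.Related X X') (p : N.carrier) :
    mvfderiv (𝓡 (2 * n)) (f ∘ N.incl) p (X p)
      = mvfderiv (𝓡 (2 * n + 1)) f (N.incl p) (X' (N.incl p)) := by
  rw [mvfderiv_comp_apply p ((hf _).mdifferentiableAt (by simp))
    ((N.contMDiff_incl p).mdifferentiableAt (by simp)), ← hX.dincl_eq]

theorem dincl_mlieBracket (hX : N.Related X X') (hY : N.Related Y Y') (p : N.carrier) :
    N.dincl p (VectorField.mlieBracket (𝓡 (2 * n)) X Y p)
      = VectorField.mlieBracket (𝓡 (2 * n + 1)) X' Y' (N.incl p) :=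
  mfderiv_mlieBracket_of_related N.contMDiff_incl hX.smooth_left hY.smooth_left hX.smooth_right
    hY.smooth_right hX.dincl_eq hY.dincl_eq p

theorem koszul_eq_of_related (hX : N.Related X X') (hY : N.Related Y Y') (hZ : N.Related Z Z')
    (p : N.carrier) : koszul X Y Z p = koszul X' Y' Z' (N.incl p) := by
  have d {A B C : Π p : N.carrier, TangentSpace (𝓡 (2 * n)) p}
      {A' B' C' : Π x : M, TangentSpace (𝓡 (2 * n + 1)) x} (hA : N.Related A A')
      (hB : N.Related B B') (hC : N.Related C C') :
      mvfderiv (𝓡 (2 * n)) (fun q ↦ (inner ℝ (A q) (B q) : ℝ)) p (C p)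
      = mvfderiv (𝓡 (2 * n + 1)) (fun q ↦ (inner ℝ (A' q) (B' q) : ℝ)) (N.incl p)
        (C' (N.incl p)) := by
    rw [← mvfderiv_comp_incl (contMDiff_inner hA.smooth_right hB.smooth_right) hC]
    congr 2
    funext q
    exact inner_eq_of_related hA hB q
  have e {A B C : Π p : N.carrier, TangentSpace (𝓡 (2 * n)) p}
      {A' B' C' : Π x : M, TangentSpace (𝓡 (2 * n + 1)) x} (hA : N.Related A A')
      (hB : N.Related B B') (hC : N.Related C C') :
      (inner ℝ (VectorField.mlieBracket (𝓡 (2 * n)) A B p) (C p) : ℝ)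
      = inner ℝ (VectorField.mlieBracket (𝓡 (2 * n + 1)) A' B' (N.incl p)) (C' (N.incl p)) := by
    rw [N.inner_eq, hC.dincl_eq, dincl_mlieBracket hA hB]
  rw [koszul, koszul, d hY hZ hX, d hZ hX hY, d hX hY hZ, e hX hY hZ, e hZ hX hY, e hZ hY hX]

/-- The Gauss formula: the Levi-Civita connection of `N` is the horizontal part of that of `M`. -/
theorem related_nabla (hS : S.IsParaSasakiLike) (hX : N.Related X X') (hY : N.Related Y Y') :
    N.Related (nabla X Y)
      (nabla X' Y' + (fun q ↦ (inner ℝ (S.φ q (X' q)) (Y' q) : ℝ)) • S.ξ) := by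
  have hη : ∀ q, S.η q ((nabla X' Y' + (fun q ↦ (inner ℝ (S.φ q (X' q)) (Y' q) : ℝ)) • S.ξ) q)
      = 0 := by
    intro q
    rw [Pi.add_apply, map_add, ← S.inner_xi, hS.inner_nabla_eq hY.smooth_right hY.eta_eq_zero]
    simp [S.eta_xi]
  refine ⟨contMDiff_nabla hX.smooth_left hY.smooth_left,
    (contMDiff_nabla hX.smooth_right hY.smooth_right).add_section
      ((contMDiff_inner (S.smooth_phi.contMDiff_apply hX.smooth_right) hY.smooth_right).smul_section
        S.smooth_xi), hη, fun p ↦ ?_⟩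
  obtain ⟨u, hu⟩ := N.exists_dincl_eq (hη (N.incl p))
  rw [← hu]
  congr 1
  refine ext_inner_right ℝ fun w ↦ ?_
  obtain ⟨Z, Z', hZ, rfl⟩ := N.exists_related w
  have h1 := two_mul_inner_nabla hX.smooth_left hY.smooth_left hZ.smooth_left p
  have h2 := two_mul_inner_nabla hX.smooth_right hY.smooth_right hZ.smooth_right (N.incl p)
  rw [koszul_eq_of_related hX hY hZ, ← h2] at h1
  rw [N.inner_eq p u, hu, hZ.dincl_eq, Pi.add_apply, inner_add_left, Pi.smul_apply',
    real_inner_smul_left, real_inner_comm (Z' _) (S.ξ _), S.inner_xi, hZ.eta_eq_zero]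
  linarith

theorem related_P (hX : N.Related X X') :
    N.Related (fun p ↦ N.P p (X p)) (fun q ↦ S.φ q (X' q)) := by
  obtain ⟨Y, hY⟩ := N.exists_related_of_eta_eq_zero
    (S.smooth_phi.contMDiff_apply hX.smooth_right) (fun q ↦ S.eta_phi q _)
  have e : Y = fun p ↦ N.P p (X p) := by
    funext p
    refine N.dincl_injective p ?_
    rw [hY.dincl_eq, ← hX.dincl_eq]
    exact (N.mfderiv_P p (X p)).symm
  rwa [← e]

variable (N)

theorem dincl_P (p : N.carrier) (u : TangentSpace (𝓡 (2 * n)) p) :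
    N.dincl p (N.P p u) = S.φ (N.incl p) (N.dincl p u) := N.mfderiv_P p u

theorem smoothEnd_P : SmoothEnd N.P := by
  refine contMDiff_hom_of_apply (E' := EuclideanSpace ℝ (Fin (2 * n)))
    (V := fun p : N.carrier ↦ TangentSpace (𝓡 (2 * n)) p) fun X hX ↦ ?_
  refine contMDiff_of_inner (X := fun q ↦ N.P q (X q)) fun W hW ↦ ?_
  have e : (fun q ↦ (inner ℝ (N.P q (X q)) (W q) : ℝ))
      = fun q ↦ inner ℝ (S.φ (N.incl q) (N.dincl q (X q))) (N.dincl q (W q)) := by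
    funext q; rw [N.inner_eq, ← N.dincl_P]
  rw [e]
  refine ContMDiff.inner_bundle (E := fun x : M ↦ TangentSpace (𝓡 (2 * n + 1)) x)
    (F := EuclideanSpace ℝ (Fin (2 * n + 1))) ?_ (N.contMDiff_dincl_apply hW)
  exact ContMDiff.clm_bundle_apply (F₁ := EuclideanSpace ℝ (Fin (2 * n + 1)))
    (F₂ := EuclideanSpace ℝ (Fin (2 * n + 1)))
    (E₁ := fun x : M ↦ TangentSpace (𝓡 (2 * n + 1)) x)
    (E₂ := fun x : M ↦ TangentSpace (𝓡 (2 * n + 1)) x)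
    (b := N.incl) (ϕ := fun q ↦ S.φ (N.incl q)) (v := fun q ↦ N.dincl q (X q))
    (S.smooth_phi.comp N.contMDiff_incl) (N.contMDiff_dincl_apply hX)

theorem P_P (p : N.carrier) (u : TangentSpace (𝓡 (2 * n)) p) : N.P p (N.P p u) = u := by
  refine N.dincl_injective p ?_
  rw [N.dincl_P, N.dincl_P, S.phi_phi_of_eta_eq_zero (N.eta_dincl p u)]

theorem finrank_eigenspace_P (p : N.carrier) {c : ℝ} (hc : c ≠ 0) :
    Module.finrank ℝ (Module.End.eigenspace (N.P p).toLinearMap c)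
      = Module.finrank ℝ (Module.End.eigenspace (S.φ (N.incl p)).toLinearMap c) := by
  have e : (Module.End.eigenspace (N.P p).toLinearMap c).map (N.dincl p).toLinearMap
      = Module.End.eigenspace (S.φ (N.incl p)).toLinearMap c := by
    ext v
    simp only [Submodule.mem_map, Module.End.mem_eigenspace_iff, ContinuousLinearMap.coe_coe]
    constructor
    · rintro ⟨u, hu, rfl⟩
      rw [← N.dincl_P, hu, map_smul]
    · intro hv
      have h := S.eta_phi (N.incl p) v
      rw [hv, map_smul, smul_eq_mul, mul_eq_zero, or_iff_right hc] at h
      obtain ⟨u, rfl⟩ := N.exists_dincl_eq h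
      refine ⟨u, N.dincl_injective p ?_, rfl⟩
      rw [N.dincl_P, hv, map_smul]
  rw [← e]
  exact (Submodule.equivMapOfInjective (N.dincl p).toLinearMap (N.dincl_injective p) _).finrank_eq

theorem isPhpcR (hS : S.IsParaSasakiLike) : IsPhpcR N.P where
  smooth := N.smoothEnd_P
  sq := N.P_P
  finrank_one p := by rw [N.finrank_eigenspace_P p one_ne_zero, S.finrank_one]
  finrank_neg_one p := by
    rw [N.finrank_eigenspace_P p (neg_ne_zero.2 one_ne_zero), S.finrank_neg_one]
  inner_P p u v := by
    rw [N.inner_eq, N.inner_eq, N.dincl_P, N.dincl_P, S.inner_phi, N.eta_dincl]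
    ring
  nabla_P p u v := by
    obtain ⟨X, X', hX, rfl⟩ := N.exists_related u
    obtain ⟨Y, Y', hY, rfl⟩ := N.exists_related v
    refine N.dincl_injective p ?_
    have h := nablaEnd_eq (X := X') S.smooth_phi hY.smooth_right (N.incl p)
    rw [hS.nablaEnd_phi, hX.eta_eq_zero, hY.eta_eq_zero] at h
    rw [nablaEnd_eq N.smoothEnd_P hY.smooth_left, map_sub, map_zero, N.dincl_P,
      (related_nabla hS hX (related_P hY)).dincl_eq, (related_nabla hS hX hY).dincl_eq]
    simp only [Pi.add_apply, Pi.smul_apply', map_add, map_smul, S.phi_xi, S.inner_phi,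
      hX.eta_eq_zero]
    rw [add_sub_right_comm, smul_zero, add_zero, ← h]
    module

end IntegralManifold
end IntegralManifoldGeometry

/-! ### The Gauss equation and the comparison of Ricci tensors -/

section RicciComparison

variable {n : ℕ} {M : Type u} [TopologicalSpace M] [T2Space M]
  [ChartedSpace (EuclideanSpace ℝ (Fin (2 * n + 1))) M] [IsManifold (𝓡 (2 * n + 1)) ∞ M]
  [RiemannianBundle (fun x : M ↦ TangentSpace (𝓡 (2 * n + 1)) x)]
  [IsContMDiffRiemannianBundle (𝓡 (2 * n + 1)) ∞ (EuclideanSpace ℝ (Fin (2 * n + 1)))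
    (fun x : M ↦ TangentSpace (𝓡 (2 * n + 1)) x)]
  {S : ApcpcR n M}

namespace IntegralManifold

variable {N : IntegralManifold S}
  {X Y Z W : Π p : N.carrier, TangentSpace (𝓡 (2 * n)) p}
  {X' Y' Z' W' : Π x : M, TangentSpace (𝓡 (2 * n + 1)) x}

theorem related_mlieBracket (hS : S.IsParaSasakiLike) (hX : N.Related X X')
    (hY : N.Related Y Y') : N.Related (VectorField.mlieBracket (𝓡 (2 * n)) X Y)
      (VectorField.mlieBracket (𝓡 (2 * n + 1)) X' Y') := by
  refine ⟨contMDiff_mlieBracket hX.smooth_left hY.smooth_left,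
    contMDiff_mlieBracket hX.smooth_right hY.smooth_right, fun q ↦ ?_, dincl_mlieBracket hX hY⟩
  rw [← nabla_sub_nabla_swap hX.smooth_right hY.smooth_right, map_sub, ← S.inner_xi, ← S.inner_xi,
    hS.inner_nabla_eq hY.smooth_right hY.eta_eq_zero,
    hS.inner_nabla_eq hX.smooth_right hX.eta_eq_zero, S.inner_phi_left, real_inner_comm]
  ring

/-- The iterated form of the Gauss formula. -/
theorem inner_nabla_nabla (hS : S.IsParaSasakiLike) (hX : N.Related X X') (hY : N.Related Y Y')
    (hZ : N.Related Z Z') (hW : N.Related W W') (p : N.carrier) :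
    (inner ℝ (nabla X (nabla Y Z) p) (W p) : ℝ)
      = inner ℝ (nabla X' (nabla Y' Z') (N.incl p)) (W' (N.incl p))
        + inner ℝ (S.φ (N.incl p) (Y' (N.incl p))) (Z' (N.incl p))
          * inner ℝ (S.φ (N.incl p) (X' (N.incl p))) (W' (N.incl p)) := by
  have hYZ := related_nabla hS hY hZ
  have hf := contMDiff_inner (S.smooth_phi.contMDiff_apply hY.smooth_right) hZ.smooth_right
  have hξ : (inner ℝ (S.ξ (N.incl p)) (W' (N.incl p)) : ℝ) = 0 := by
    rw [real_inner_comm, S.inner_xi, hW.eta_eq_zero]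
  rw [inner_eq_of_related (related_nabla hS hX hYZ) hW, Pi.add_apply, Pi.smul_apply',
    nabla_add_right (contMDiff_nabla hY.smooth_right hZ.smooth_right)
      (hf.smul_section S.smooth_xi), nabla_smul_right hf S.smooth_xi, hS.nabla_xi]
  simp only [inner_add_left, real_inner_smul_left, hξ]
  ring

/-- The Gauss equation. -/
theorem inner_curvature_dincl (hS : S.IsParaSasakiLike) (p : N.carrier)
    (x y z w : TangentSpace (𝓡 (2 * n)) p) :
    (inner ℝ (curvature (N.incl p) (N.dincl p x) (N.dincl p y) (N.dincl p z)) (N.dincl p w) : ℝ)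
      = inner ℝ (curvature p x y z) w - inner ℝ (N.P p y) z * inner ℝ (N.P p x) w
        + inner ℝ (N.P p x) z * inner ℝ (N.P p y) w := by
  obtain ⟨X, X', hX, rfl⟩ := N.exists_related x
  obtain ⟨Y, Y', hY, rfl⟩ := N.exists_related y
  obtain ⟨Z, Z', hZ, rfl⟩ := N.exists_related z
  obtain ⟨W, W', hW, rfl⟩ := N.exists_related w
  have hξ : (inner ℝ (S.ξ (N.incl p)) (W' (N.incl p)) : ℝ) = 0 := by
    rw [real_inner_comm, S.inner_xi, hW.eta_eq_zero]
  have h3 := inner_eq_of_related (related_nabla hS (related_mlieBracket hS hX hY) hZ) hW p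
  rw [Pi.add_apply, Pi.smul_apply', inner_add_left, real_inner_smul_left, hξ, mul_zero,
    add_zero] at h3
  rw [curvature_eq hX.smooth_left hY.smooth_left hZ.smooth_left, hX.dincl_eq, hY.dincl_eq,
    hZ.dincl_eq, hW.dincl_eq, curvature_eq hX.smooth_right hY.smooth_right hZ.smooth_right,
    curvatureField_eq, curvatureField_eq]
  simp only [inner_sub_left]
  rw [inner_nabla_nabla hS hX hY hZ hW, inner_nabla_nabla hS hY hX hZ hW, h3,
    inner_eq_of_related (related_P hY) hZ, inner_eq_of_related (related_P hX) hW,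
    inner_eq_of_related (related_P hX) hZ, inner_eq_of_related (related_P hY) hW]
  ring

variable (N) in
/-- An orthonormal basis of `T_p N`, completed by `ξ` to an orthonormal basis of `T_p M`. -/
theorem exists_orthonormalBasis_adapted (p : N.carrier) {ι : Type*} [Fintype ι]
    (b : OrthonormalBasis ι ℝ (TangentSpace (𝓡 (2 * n)) p)) :
    ∃ b' : OrthonormalBasis (Option ι) ℝ (TangentSpace (𝓡 (2 * n + 1)) (N.incl p)),
      b' none = S.ξ (N.incl p) ∧ ∀ i, b' (some i) = N.dincl p (b i) := by
  classical
  let v : Option ι → TangentSpace (𝓡 (2 * n + 1)) (N.incl p) := fun o ↦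
    o.elim (S.ξ (N.incl p)) (fun i ↦ N.dincl p (b i))
  have hv : Orthonormal ℝ v := by
    rw [orthonormal_iff_ite]
    rintro (_ | i) (_ | j)
    · simp only [v, Option.elim]
      rw [S.inner_xi, S.eta_xi]
      simp
    · simp only [v, Option.elim]
      rw [real_inner_comm, S.inner_xi, N.eta_dincl]
      simp
    · simp only [v, Option.elim]
      rw [S.inner_xi, N.eta_dincl]
      simp
    · simp only [v, Option.elim]
      rw [← N.inner_eq, orthonormal_iff_ite.1 b.orthonormal]
      simp
  have hι : Fintype.card ι = 2 * n := by
    rw [← Module.finrank_eq_card_basis b.toBasis]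
    exact finrank_euclideanSpace_fin
  have hcard : Fintype.card (Option ι)
      = Module.finrank ℝ (TangentSpace (𝓡 (2 * n + 1)) (N.incl p)) := by
    rw [Fintype.card_option, hι]
    exact finrank_euclideanSpace_fin.symm
  refine ⟨OrthonormalBasis.mk hv ?_, ?_, ?_⟩
  · exact (hv.linearIndependent.span_eq_top_of_card_eq_finrank' hcard).ge
  · simp [v]
  · simp [v]

/-- The Ricci tensor of `N` is the restriction of the Ricci tensor of `M`. The contributions of the
normal direction `ξ` and of the second fundamental form cancel, as `P` is trace-free and an
involutive isometry. -/
theorem ricci_dincl (hS : S.IsParaSasakiLike) (p : N.carrier)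
    (y z : TangentSpace (𝓡 (2 * n)) p) :
    ricci (N.incl p) (N.dincl p y) (N.dincl p z) = ricci p y z := by
  let b := stdOrthonormalBasis ℝ (TangentSpace (𝓡 (2 * n)) p)
  obtain ⟨b', hb', hb⟩ := N.exists_orthonormalBasis_adapted p b
  have hP := N.isPhpcR hS
  have hPs (u v : TangentSpace (𝓡 (2 * n)) p) : (inner ℝ (N.P p u) v : ℝ) = inner ℝ u (N.P p v) := by
    rw [← hP.inner_P, N.P_P]
  have hξ : (inner ℝ (curvature (N.incl p) (S.ξ (N.incl p)) (N.dincl p y) (N.dincl p z))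
      (S.ξ (N.incl p)) : ℝ) = -inner ℝ y z := by
    rw [inner_curvature_skew, hS.curvature_xi, N.eta_dincl, S.eta_xi, one_smul, zero_smul,
      sub_zero, N.inner_eq]
  have htr : ∑ i, (inner ℝ (N.P p (b i)) (b i) : ℝ) = 0 := by
    have h := trace_eq_zero_of_involution (P := (N.P p).toLinearMap) (hP.sq p)
      ((hP.finrank_one p).trans (hP.finrank_neg_one p).symm)
    rw [LinearMap.trace_eq_sum_inner _ b] at h
    simp only [real_inner_comm (b _)] at h ⊢
    exact h
  have hsum : ∑ i, (inner ℝ (N.P p (b i)) z * inner ℝ (N.P p y) (b i) : ℝ) = inner ℝ y z := by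
    rw [← hP.inner_P p y z, ← b.sum_inner_mul_inner]
    refine Finset.sum_congr rfl fun i _ ↦ ?_
    rw [hPs (b i), mul_comm]
  rw [ricci_eq_sum b', Fintype.sum_option, hb', hξ, ricci_eq_sum b]
  simp only [hb, inner_curvature_dincl hS]
  rw [Finset.sum_add_distrib, Finset.sum_sub_distrib, ← Finset.mul_sum, htr, hsum]
  ring

/-- `Ric(ξ, ξ) = -2n` determines the Einstein constant of `M`, and the Ricci tensor restricts. -/
theorem ricciEq_of_isEinstein (hS : S.IsParaSasakiLike)
    (h : IsEinstein (𝓡 (2 * n + 1)) M) (N : IntegralManifold S) :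
    RicciEq (𝓡 (2 * n)) N.carrier (-2 * (n : ℝ)) := by
  obtain ⟨c, hc⟩ := h
  intro p x y
  have h1 := hc (N.incl p) (S.ξ _) (S.ξ _)
  rw [hS.ricci_xi, S.inner_xi, S.eta_xi, mul_one, mul_one] at h1
  rw [← ricci_dincl hS, hc, h1, N.inner_eq]

theorem isEinstein_of_ricciEq (hS : S.IsParaSasakiLike)
    (h : ∀ x : M, ∃ N : IntegralManifold S, x ∈ Set.range N.incl ∧
      RicciEq (𝓡 (2 * n)) N.carrier (-2 * (n : ℝ))) :
    IsEinstein (𝓡 (2 * n + 1)) M := by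
  refine ⟨-2 * n, fun q x y ↦ ?_⟩
  obtain ⟨N, ⟨p, rfl⟩, hN⟩ := h q
  obtain ⟨u, hu⟩ := N.exists_dincl_eq (S.eta_sub _ x)
  obtain ⟨v, hv⟩ := N.exists_dincl_eq (S.eta_sub _ y)
  have hx : x = N.dincl p u + S.η _ x • S.ξ (N.incl p) := by rw [hu]; abel
  have hy : y = N.dincl p v + S.η _ y • S.ξ (N.incl p) := by rw [hv]; abel
  have h1 := hN p u v
  rw [← ricci_dincl hS, N.inner_eq] at h1
  have h2 (w : TangentSpace (𝓡 (2 * n + 1)) (N.incl p)) :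
      ricci (N.incl p) (S.ξ _) w = -2 * n * inner ℝ (S.ξ _) w := by
    rw [ricci_symm, hS.ricci_xi, real_inner_comm]
  rw [hx, hy]
  simp only [ricci_add_left, ricci_add_right, ricci_smul_left, ricci_smul_right, hS.ricci_xi, h1,
    h2, inner_add_left, inner_add_right, real_inner_smul_left, real_inner_smul_right]
  ring

end IntegralManifold

/-- In dimension `m ≥ 1`, `Ric = c g` amounts to being Einstein with scalar
curvature `m c`. -/
theorem ricciEq_iff_isEinstein_and_scalarCurvature {m : ℕ} (hm : m ≠ 0) {N : Type*}
    [TopologicalSpace N] [ChartedSpace (EuclideanSpace ℝ (Fin m)) N] [IsManifold (𝓡 m) ∞ N]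
    [RiemannianBundle (fun x : N ↦ TangentSpace (𝓡 m) x)]
    [IsContMDiffRiemannianBundle (𝓡 m) ∞ (EuclideanSpace ℝ (Fin m))
      (fun x : N ↦ TangentSpace (𝓡 m) x)] (c : ℝ) :
    RicciEq (𝓡 m) N c ↔ IsEinstein (𝓡 m) N ∧ ∀ p : N, scalarCurvature (𝓡 m) p = m * c := by
  have key (d : ℝ) (h : RicciEq (𝓡 m) N d) (p : N) : scalarCurvature (𝓡 m) p = m * d := by
    have hfr : Module.finrank ℝ (TangentSpace (𝓡 m) p) = m := finrank_euclideanSpace_fin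
    simp only [scalarCurvature, h p, real_inner_self_eq_norm_sq, OrthonormalBasis.norm_eq_one]
    simp [hfr]
  refine ⟨fun h ↦ ⟨⟨c, h⟩, key c h⟩, ?_⟩
  rintro ⟨⟨d, hd⟩, h⟩ p
  have h1 := key d hd p
  rw [h p] at h1
  have h2 : c = d := mul_left_cancel₀ (Nat.cast_ne_zero.2 hm) h1
  rw [h2]
  exact hd p

end RicciComparison

/-! ### Closed forms and the Poincaré lemma in a chart -/

section ClosedForms

variable {E : Type*} [NormedAddCommGroup E] [NormedSpace ℝ E] [FiniteDimensional ℝ E]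
  {H : Type*} [TopologicalSpace H] {I : ModelWithCorners ℝ E H} [I.Boundaryless]
  {M : Type*} [TopologicalSpace M] [ChartedSpace H M] [IsManifold I ∞ M]

variable (I) in
/-- The vector field near `p` whose representative in the preferred chart at `p` is the constant
field `u`. Outside the chart domain it has no geometric meaning. -/
noncomputable def coordField (p : M) (u : E) (q : M) : TangentSpace I q :=
  VectorField.mpullback I 𝓘(ℝ, E) (extChartAt I p) (fun _ ↦ u) q

theorem contMDiffAt_coordField {p q : M} (hq : q ∈ (extChartAt I p).source) (u : E) :
    CMDiffAt ∞ (T% (coordField I p u)) q := by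
  have : CompleteSpace E := FiniteDimensional.complete ℝ E
  have hq' := hq
  rw [extChartAt_source] at hq'
  have hV : CMDiffAt ∞ (fun y : E ↦ (⟨y, u⟩ : TangentBundle 𝓘(ℝ, E) E)) (extChartAt I p q) :=
    contMDiffAt_vectorSpace_iff_contDiffAt.2 contDiffAt_const
  exact ContMDiffAt.mpullback_vectorField_preimage (n := ∞) hV (contMDiffAt_extChartAt' hq')
    (isInvertible_mfderiv_extChartAt hq) (by simp)

theorem mlieBracket_coordField {p q : M} (hq : q ∈ (extChartAt I p).source) (u v : E) :
    VectorField.mlieBracket I (coordField I p u) (coordField I p v) q = 0 := by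
  have : CompleteSpace E := FiniteDimensional.complete ℝ E
  have : IsManifold I (minSmoothness ℝ 3) M := by
    rw [minSmoothness_of_isRCLikeNormedField]; infer_instance
  have hq' := hq
  rw [extChartAt_source] at hq'
  have hV (w : E) : MDiffAt (fun y : E ↦ (⟨y, w⟩ : TangentBundle 𝓘(ℝ, E) E)) (extChartAt I p q) :=
    ((contMDiffAt_vectorSpace_iff_contDiffAt (n := ∞)).2 contDiffAt_const).mdifferentiableAt
      (by simp)
  have h := VectorField.mpullback_mlieBracket (n := ∞) (hV u) (hV v)
    (contMDiffAt_extChartAt' (I := I) hq')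
    (by rw [minSmoothness_of_isRCLikeNormedField]; exact ENat.LEInfty.out)
  change _ = VectorField.mlieBracket I (coordField I p u) (coordField I p v) q at h
  have h0 : VectorField.mlieBracket 𝓘(ℝ, E) (fun y : E ↦ (u : TangentSpace 𝓘(ℝ, E) y))
      (fun y : E ↦ (v : TangentSpace 𝓘(ℝ, E) y)) (extChartAt I p q) = 0 := by
    have h1 (V W : Π y : E, TangentSpace 𝓘(ℝ, E) y) :
        VectorField.mlieBracket 𝓘(ℝ, E) V W = VectorField.lieBracket ℝ V W := by
      rw [← VectorField.mlieBracketWithin_univ, VectorField.mlieBracketWithin_eq_lieBracketWithin]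
      exact VectorField.lieBracketWithin_univ
    refine (congrFun (h1 _ _) _).trans ?_
    change fderiv ℝ (fun _ : E ↦ v) _ u - fderiv ℝ (fun _ : E ↦ u) _ v = 0
    simp
  rw [← h]
  exact (congrArg _ h0).trans (map_zero _)

variable [T2Space M]

theorem exists_smoothField_coordField {p q : M} (hq : q ∈ (extChartAt I p).source) (u : E) :
    ∃ X : Π x : M, TangentSpace I x, SmoothField X ∧ ∀ᶠ x in nhds q, X x = coordField I p u x :=
  exists_contMDiff_eventuallyEq ((isOpen_extChartAt_source p).mem_nhds hq)
    fun _ hx ↦ (contMDiffAt_coordField hx u).contMDiffWithinAt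

variable {η : Π x : M, TangentSpace I x →L[ℝ] ℝ}

theorem contMDiffAt_form_coordField (hη : SmoothForm η) {p q : M}
    (hq : q ∈ (extChartAt I p).source) (u : E) :
    CMDiffAt ∞ (fun x ↦ η x (coordField I p u x)) q := by
  obtain ⟨X, hX, hXe⟩ := exists_smoothField_coordField hq u
  refine (hη.contMDiff_apply hX q).congr_of_eventuallyEq ?_
  filter_upwards [hXe] with x hx
  rw [hx]

/-- The components of a closed form in a chart satisfy the integrability condition, because
coordinate fields commute. -/
theorem mvfderiv_form_coordField_symm
    (hdη : ∀ X Y : Π x : M, TangentSpace I x, SmoothField X → SmoothField Y → ∀ p,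
      mvfderiv I (fun q ↦ η q (Y q)) p (X p) - mvfderiv I (fun q ↦ η q (X q)) p (Y p)
        = η p (VectorField.mlieBracket I X Y p)) {p q : M}
    (hq : q ∈ (extChartAt I p).source) (u v : E) :
    mvfderiv I (fun x ↦ η x (coordField I p v x)) q (coordField I p u q)
      = mvfderiv I (fun x ↦ η x (coordField I p u x)) q (coordField I p v q) := by
  obtain ⟨X, hX, hXe⟩ := exists_smoothField_coordField hq u
  obtain ⟨Y, hY, hYe⟩ := exists_smoothField_coordField hq v
  have h := hdη X Y hX hY q
  have e1 : mvfderiv I (fun x ↦ η x (Y x)) q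
      = mvfderiv I (fun x ↦ η x (coordField I p v x)) q :=
    Filter.EventuallyEq.mfderiv_eq (hYe.mono fun x hx ↦ by simp only [hx])
  have e2 : mvfderiv I (fun x ↦ η x (X x)) q
      = mvfderiv I (fun x ↦ η x (coordField I p u x)) q :=
    Filter.EventuallyEq.mfderiv_eq (hXe.mono fun x hx ↦ by simp only [hx])
  have e3 : VectorField.mlieBracket I X Y q = 0 := by
    rw [Filter.EventuallyEq.mlieBracket_vectorField_eq hXe hYe, mlieBracket_coordField hq]
  rw [e1, e2, e3, hXe.self_of_nhds, hYe.self_of_nhds, map_zero, sub_eq_zero] at h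
  exact h

/-- The Poincaré lemma: a closed form `η` has a primitive `f`, written here in the preferred chart
at `p`. -/
theorem exists_primitive (hη : SmoothForm η)
    (hdη : ∀ X Y : Π x : M, TangentSpace I x, SmoothField X → SmoothField Y → ∀ p,
      mvfderiv I (fun q ↦ η q (Y q)) p (X p) - mvfderiv I (fun q ↦ η q (X q)) p (Y p)
        = η p (VectorField.mlieBracket I X Y p)) (p : M) :
    ∃ (r : ℝ) (f : E → ℝ), 0 < r ∧ Metric.ball (extChartAt I p p) r ⊆ (extChartAt I p).target ∧
      ContDiffOn ℝ ∞ f (Metric.ball (extChartAt I p p) r) ∧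
      ∀ y ∈ Metric.ball (extChartAt I p p) r, HasFDerivAt f
        ((η ((extChartAt I p).symm y)).comp
          (mfderiv I 𝓘(ℝ, E) (extChartAt I p) ((extChartAt I p).symm y)).inverse) y := by
  obtain ⟨r, hr, hrt⟩ := Metric.isOpen_iff.1 (isOpen_extChartAt_target (I := I) p) _
    (mem_extChartAt_target p)
  -- `α` is the form in the chart, with `α y v = η (coordField I p v)`
  let α : E → E →L[ℝ] ℝ := fun y ↦ (η ((extChartAt I p).symm y)).comp
    (mfderiv I 𝓘(ℝ, E) (extChartAt I p) ((extChartAt I p).symm y)).inverse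
  have hαv (v : E) : (fun y ↦ α y v)
      = (fun x ↦ η x (coordField I p v x)) ∘ (extChartAt I p).symm := rfl
  have hsm (y : E) (hy : y ∈ (extChartAt I p).target) :
      ContMDiffAt 𝓘(ℝ, E) I ∞ (extChartAt I p).symm y :=
    (contMDiffOn_extChartAt_symm p).contMDiffAt ((isOpen_extChartAt_target p).mem_nhds hy)
  have hsrc (y : E) (hy : y ∈ (extChartAt I p).target) :=
    (extChartAt I p).map_target hy
  have hαvs (v : E) (y : E) (hy : y ∈ (extChartAt I p).target) :
      ContMDiffAt 𝓘(ℝ, E) 𝓘(ℝ, ℝ) ∞ (fun y ↦ α y v) y :=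
    (contMDiffAt_form_coordField hη (hsrc y hy) v).comp y (hsm y hy)
  have hα (y : E) (hy : y ∈ (extChartAt I p).target) : ContDiffAt ℝ ∞ α y :=
    (contMDiffAt_clm_of_basis (I := 𝓘(ℝ, E)) (Module.finBasis ℝ E)
      fun i ↦ hαvs _ y hy).contDiffAt
  have hdα (y : E) (hy : y ∈ (extChartAt I p).target) (u v : E) :
      fderiv ℝ α y u v = mvfderiv I (fun x ↦ η x (coordField I p v x)) ((extChartAt I p).symm y)
        (coordField I p u ((extChartAt I p).symm y)) := by
    have hd : DifferentiableAt ℝ α y := (hα y hy).differentiableAt (by simp)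
    have h1 : fderiv ℝ (fun y ↦ α y v) y u = fderiv ℝ α y u v := by
      rw [fderiv_clm_apply hd (differentiableAt_const v)]
      simp
    have h2 : mfderiv 𝓘(ℝ, E) I (extChartAt I p).symm y u
        = coordField I p u ((extChartAt I p).symm y) := by
      have hinv := isInvertible_mfderiv_extChartAt (hsrc y hy)
      refine Eq.symm ((hinv.inverse_apply_eq).2 ?_)
      have := mfderiv_extChartAt_comp_mfderivWithin_extChartAt_symm (I := I) hy
      rw [I.range_eq_univ, mfderivWithin_univ] at this
      exact (congrArg (fun L : E →L[ℝ] E ↦ L u) this).symm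
    rw [← h1, ← mfderiv_eq_fderiv, hαv]
    rw [mfderiv_comp y ((contMDiffAt_form_coordField hη (hsrc y hy) v).mdifferentiableAt (by simp))
      ((hsm y hy).mdifferentiableAt (by simp))]
    rw [← h2]
    rfl
  obtain ⟨f, hf⟩ := (convex_ball (extChartAt I p p) r).exists_forall_hasFDerivAt_of_fderiv_symmetric
    Metric.isOpen_ball
    (fun y hy ↦ ((hα y (hrt hy)).differentiableAt (by simp)).differentiableWithinAt)
    (fun y hy u v ↦ by
      rw [hdα y (hrt hy), hdα y (hrt hy), mvfderiv_form_coordField_symm hdη (hsrc y (hrt hy))])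
  refine ⟨r, f, hr, hrt, ?_, hf⟩
  rw [contDiffOn_infty_iff_fderiv_of_isOpen Metric.isOpen_ball]
  refine ⟨fun y hy ↦ (hf y hy).differentiableAt.differentiableWithinAt, ?_⟩
  exact ContDiffOn.congr (f := α) (fun y hy ↦ (hα y (hrt hy)).contDiffWithinAt)
    fun y hy ↦ (hf y hy).fderiv

end ClosedForms

/-! ### The structure form is closed -/

section StructureForm

variable {n : ℕ} {M : Type u} [TopologicalSpace M] [T2Space M]
  [ChartedSpace (EuclideanSpace ℝ (Fin (2 * n + 1))) M] [IsManifold (𝓡 (2 * n + 1)) ∞ M]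
  [RiemannianBundle (fun x : M ↦ TangentSpace (𝓡 (2 * n + 1)) x)]
  [IsContMDiffRiemannianBundle (𝓡 (2 * n + 1)) ∞ (EuclideanSpace ℝ (Fin (2 * n + 1)))
    (fun x : M ↦ TangentSpace (𝓡 (2 * n + 1)) x)]
  {S : ApcpcR n M}

/-- `dη = 0`, as `∇_x ξ = φ x` and `φ` is symmetric. -/
theorem ApcpcR.IsParaSasakiLike.eta_closed (hS : S.IsParaSasakiLike)
    {X Y : Π x : M, TangentSpace (𝓡 (2 * n + 1)) x} (hX : SmoothField X) (hY : SmoothField Y)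
    (p : M) :
    mvfderiv (𝓡 (2 * n + 1)) (fun q ↦ S.η q (Y q)) p (X p)
        - mvfderiv (𝓡 (2 * n + 1)) (fun q ↦ S.η q (X q)) p (Y p)
      = S.η p (VectorField.mlieBracket (𝓡 (2 * n + 1)) X Y p) := by
  simp only [← S.inner_xi]
  rw [mvfderiv_inner hY S.smooth_xi, mvfderiv_inner hX S.smooth_xi, hS.nabla_xi, hS.nabla_xi,
    ← nabla_sub_nabla_swap hX hY, inner_sub_left, ← S.inner_phi_left, real_inner_comm (X p)]
  ring

end StructureForm

/-! ### Level sets of primitives -/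

section LocalLeaf

/-- A submersion `f` to the line has smoothly parametrized level sets: the parametrization `k` is
inverse to the restriction of a linear map `τ`. -/
theorem exists_level_parametrization {E F : Type*} [NormedAddCommGroup E] [NormedSpace ℝ E]
    [FiniteDimensional ℝ E] [NormedAddCommGroup F] [NormedSpace ℝ F] [FiniteDimensional ℝ F]
    (hEF : Module.finrank ℝ E = Module.finrank ℝ F + 1) {B : Set E} (hB : IsOpen B) {y₀ : E}
    (hy₀ : y₀ ∈ B) {f : E → ℝ} (hf : ContDiffOn ℝ ∞ f B) {α : E → E →L[ℝ] ℝ}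
    (hα : ∀ y ∈ B, HasFDerivAt f (α y) y) (h0 : α y₀ ≠ 0) :
    ∃ (U : Set F) (w₀ : F) (k : F → E) (τ : E →L[ℝ] F), IsOpen U ∧ w₀ ∈ U ∧ k w₀ = y₀ ∧
      ContDiffOn ℝ ∞ k U ∧ ∀ w ∈ U, k w ∈ B ∧ f (k w) = f y₀ ∧ τ (k w) = w := by
  have : CompleteSpace E := FiniteDimensional.complete ℝ E
  have : CompleteSpace F := FiniteDimensional.complete ℝ F
  -- a projection to the kernel of the derivative at `y₀`
  obtain ⟨e, he⟩ : ∃ e, α y₀ e = 1 := by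
    obtain ⟨v, hv⟩ : ∃ v, α y₀ v ≠ 0 := by
      by_contra! h
      exact h0 (ContinuousLinearMap.ext h)
    exact ⟨(α y₀ v)⁻¹ • v, by simp [hv]⟩
  have hker : Module.finrank ℝ (LinearMap.ker (α y₀).toLinearMap) = Module.finrank ℝ F := by
    have h1 := LinearMap.finrank_range_add_finrank_ker (α y₀).toLinearMap
    have h2 : LinearMap.range (α y₀).toLinearMap = ⊤ :=
      LinearMap.range_eq_top.2 fun t ↦ ⟨t • e, by simp [he]⟩
    rw [h2, finrank_top, Module.finrank_self, hEF] at h1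
    omega
  let κ := LinearEquiv.ofFinrankEq _ _ hker
  let pr : E →ₗ[ℝ] LinearMap.ker (α y₀).toLinearMap :=
    LinearMap.codRestrict _ (LinearMap.id - (α y₀).toLinearMap.smulRight e) fun v ↦ by simp [he]
  let τ : E →L[ℝ] F := LinearMap.toContinuousLinearMap (κ.toLinearMap ∘ₗ pr)
  have hinj : Function.Injective ((α y₀).prod τ) := by
    refine (injective_iff_map_eq_zero _).2 fun v hv ↦ ?_
    have h1 : α y₀ v = 0 := congrArg Prod.fst hv
    have h2 : κ (pr v) = 0 := congrArg Prod.snd hv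
    have h3 : pr v = 0 := κ.injective (by rw [h2, map_zero])
    have h4 : v - α y₀ v • e = 0 := congrArg Subtype.val h3
    rwa [h1, zero_smul, sub_zero] at h4
  let L : E ≃L[ℝ] ℝ × F := (LinearEquiv.ofInjectiveOfFinrankEq ((α y₀).prod τ).toLinearMap hinj
    (by rw [hEF, Module.finrank_prod, Module.finrank_self, add_comm])).toContinuousLinearEquiv
  have hL : (L : E →L[ℝ] ℝ × F) = (α y₀).prod τ := by
    ext v <;> rfl
  let G : E → ℝ × F := fun y ↦ (f y, τ y)
  have hG (y : E) (hy : y ∈ B) : HasFDerivAt G ((α y).prod τ) y :=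
    (hα y hy).prodMk τ.hasFDerivAt
  have hGs (y : E) (hy : y ∈ B) : ContDiffAt ℝ ∞ G y :=
    (hf.contDiffAt (hB.mem_nhds hy)).prodMk τ.contDiff.contDiffAt
  have hαc : ContinuousOn α B :=
    (hf.continuousOn_fderiv_of_isOpen hB (by simp)).congr fun y hy ↦ (hα y hy).fderiv.symm
  let T : E → E →L[ℝ] ℝ × F := fun y ↦ (α y).prod τ
  have hT : ContinuousOn T B := by
    have h : T = fun y ↦ (ContinuousLinearMap.inl ℝ ℝ F).comp (α y)
        + (ContinuousLinearMap.inr ℝ ℝ F).comp τ := by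
      funext y; ext v <;> simp [T]
    rw [h]
    exact (continuousOn_const.clm_comp hαc).add continuousOn_const
  -- `V` consists of the points at which the derivative of `G` is invertible: the local inverse of
  -- `G` is smooth at all points of `G '' V`, not only at `G y₀`
  let V : Set E := B ∩ T ⁻¹' Set.range ((↑) : (E ≃L[ℝ] ℝ × F) → E →L[ℝ] ℝ × F)
  have hV : IsOpen V := hT.isOpen_inter_preimage hB ContinuousLinearEquiv.isOpen
  have hG₀ : HasFDerivAt G (L : E →L[ℝ] ℝ × F) y₀ := hL ▸ hG y₀ hy₀
  let Φ := ((hGs y₀ hy₀).toOpenPartialHomeomorph G hG₀ (by simp)).restrOpen V hV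
  have hy₀Φ : y₀ ∈ Φ.source :=
    ⟨ContDiffAt.mem_toOpenPartialHomeomorph_source (hGs y₀ hy₀) hG₀ (by simp), hy₀, L, hL⟩
  have hΦ (a : ℝ × F) (ha : a ∈ Φ.target) : Φ.symm a ∈ V ∧ G (Φ.symm a) = a :=
    ⟨(Φ.map_target ha).2, Φ.right_inv ha⟩
  have hk (a : ℝ × F) (ha : a ∈ Φ.target) : ContDiffAt ℝ ∞ Φ.symm a := by
    obtain ⟨hB', L', hL'⟩ := (hΦ a ha).1
    exact Φ.contDiffAt_symm (f₀' := L') ha (hL' ▸ hG _ hB') (hGs _ hB')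
  refine ⟨(fun w ↦ (f y₀, w)) ⁻¹' Φ.target, τ y₀, fun w ↦ Φ.symm (f y₀, w), τ,
    Φ.open_target.preimage (by fun_prop), Φ.map_source hy₀Φ, Φ.left_inv hy₀Φ, ?_, ?_⟩
  · intro w hw
    have h : ContDiffAt ℝ ∞ (fun w : F ↦ (f y₀, w)) w := by fun_prop
    exact (ContDiffAt.comp w (hk _ hw) h).contDiffWithinAt
  · intro w hw
    obtain ⟨h1, h2⟩ := hΦ _ hw
    exact ⟨h1.1, congrArg Prod.fst h2, congrArg Prod.snd h2⟩

variable {E : Type*} [NormedAddCommGroup E] [NormedSpace ℝ E] [FiniteDimensional ℝ E]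
  {F : Type*} [NormedAddCommGroup F] [NormedSpace ℝ F] [FiniteDimensional ℝ F]
  {H : Type*} [TopologicalSpace H] {I : ModelWithCorners ℝ E H} [I.Boundaryless]
  {M : Type*} [TopologicalSpace M] [T2Space M] [ChartedSpace H M] [IsManifold I ∞ M]

/-- Through each point `x` there is a submanifold of codimension one, with a parametrization `j`,
on which the closed form `η` vanishes. The smooth map `ρ` inverts the parametrization. -/
theorem exists_parametrization_of_closed (hEF : Module.finrank ℝ E = Module.finrank ℝ F + 1)
    {η : Π x : M, TangentSpace I x →L[ℝ] ℝ} (hη : SmoothForm η)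
    (hdη : ∀ X Y : Π x : M, TangentSpace I x, SmoothField X → SmoothField Y → ∀ p,
      mvfderiv I (fun q ↦ η q (Y q)) p (X p) - mvfderiv I (fun q ↦ η q (X q)) p (Y p)
        = η p (VectorField.mlieBracket I X Y p)) {x : M} (hx : η x ≠ 0) :
    ∃ (U : Set F) (w₀ : F) (j : F → M) (ρ : M → F), IsOpen U ∧ w₀ ∈ U ∧ j w₀ = x ∧
      ContMDiffOn 𝓘(ℝ, F) I ∞ j U ∧
      ∀ w ∈ U, ρ (j w) = w ∧ ContMDiffAt I 𝓘(ℝ, F) ∞ ρ (j w) ∧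
        ∀ v, η (j w) (mfderiv 𝓘(ℝ, F) I j w v) = 0 := by
  obtain ⟨r, f, hr, hrt, hfs, hf⟩ := exists_primitive hη hdη x
  have h0 : (η ((extChartAt I x).symm (extChartAt I x x))).comp
      (mfderiv I 𝓘(ℝ, E) (extChartAt I x)
        ((extChartAt I x).symm (extChartAt I x x))).inverse ≠ 0 := by
    rw [extChartAt_to_inv]
    intro h
    refine hx (ContinuousLinearMap.ext fun v ↦ ?_)
    have hinv := isInvertible_mfderiv_extChartAt (I := I) (mem_extChartAt_source (I := I) x)
    have h1 := congrArg (fun L : E →L[ℝ] ℝ ↦ L (mfderiv I 𝓘(ℝ, E) (extChartAt I x) x v)) h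
    have h2 : (mfderiv I 𝓘(ℝ, E) (extChartAt I x) x).inverse
        (mfderiv I 𝓘(ℝ, E) (extChartAt I x) x v) = v := (hinv.inverse_apply_eq).2 rfl
    have h3 : η x ((mfderiv I 𝓘(ℝ, E) (extChartAt I x) x).inverse
        (mfderiv I 𝓘(ℝ, E) (extChartAt I x) x v)) = 0 := h1
    rw [h2] at h3
    exact h3
  obtain ⟨U, w₀, k, τ, hU, hw₀, hkw₀, hk, hkU⟩ := exists_level_parametrization hEF
    Metric.isOpen_ball (Metric.mem_ball_self hr) hfs hf h0
  have hkt (w : F) (hw : w ∈ U) : k w ∈ (extChartAt I x).target := hrt (hkU w hw).1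
  have hks (w : F) (hw : w ∈ U) : (extChartAt I x).symm (k w) ∈ (extChartAt I x).source :=
    (extChartAt I x).map_target (hkt w hw)
  have hkd (w : F) (hw : w ∈ U) : ContDiffAt ℝ ∞ k w := hk.contDiffAt (hU.mem_nhds hw)
  have hj (w : F) (hw : w ∈ U) : ContMDiffAt 𝓘(ℝ, F) I ∞ ((extChartAt I x).symm ∘ k) w :=
    ((contMDiffOn_extChartAt_symm x).contMDiffAt
      ((isOpen_extChartAt_target x).mem_nhds (hkt w hw))).comp w (hkd w hw).contMDiffAt
  have hφ (w : F) (hw : w ∈ U) :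
      ContMDiffAt I 𝓘(ℝ, E) ∞ (extChartAt I x) (((extChartAt I x).symm ∘ k) w) :=
    contMDiffAt_extChartAt' (by rw [← extChartAt_source I]; exact hks w hw)
  refine ⟨U, w₀, (extChartAt I x).symm ∘ k, τ ∘ extChartAt I x, hU, hw₀, ?_,
    fun w hw ↦ (hj w hw).contMDiffWithinAt, fun w hw ↦ ⟨?_, ?_, fun v ↦ ?_⟩⟩
  · rw [Function.comp_apply, hkw₀, extChartAt_to_inv]
  · simp only [Function.comp_apply]
    rw [(extChartAt I x).right_inv (hkt w hw), (hkU w hw).2.2]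
  · exact τ.contMDiff.contMDiffAt.comp _ (hφ w hw)
  · have e1 : fderiv ℝ k w v = mfderiv I 𝓘(ℝ, E) (extChartAt I x) (((extChartAt I x).symm ∘ k) w)
        (mfderiv 𝓘(ℝ, F) I ((extChartAt I x).symm ∘ k) w v) := by
      have h1 : extChartAt I x ∘ ((extChartAt I x).symm ∘ k) =ᶠ[nhds w] k := by
        filter_upwards [hU.mem_nhds hw] with z hz
        exact (extChartAt I x).right_inv (hkt z hz)
      have h2 := mfderiv_comp w ((hφ w hw).mdifferentiableAt (by simp))
        ((hj w hw).mdifferentiableAt (by simp))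
      rw [h1.mfderiv_eq, mfderiv_eq_fderiv] at h2
      exact congrArg (fun L : F →L[ℝ] E ↦ L v) h2
    have e2 : (η ((extChartAt I x).symm (k w))).comp (mfderiv I 𝓘(ℝ, E) (extChartAt I x)
        ((extChartAt I x).symm (k w))).inverse (fderiv ℝ k w v) = 0 := by
      have h1 : f ∘ k =ᶠ[nhds w] fun _ ↦ f (extChartAt I x x) := by
        filter_upwards [hU.mem_nhds hw] with z hz
        exact (hkU z hz).2.1
      have h2 := (hf (k w) (hkU w hw).1).comp w ((hkd w hw).differentiableAt (by simp)).hasFDerivAt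
      have h3 := h2.unique (h1.hasFDerivAt_iff.2 (hasFDerivAt_const _ w))
      exact congrArg (fun L : F →L[ℝ] ℝ ↦ L v) h3
    rw [e1] at e2
    have hinv := isInvertible_mfderiv_extChartAt (hks w hw)
    have h4 (u : TangentSpace I ((extChartAt I x).symm (k w))) :
        (mfderiv I 𝓘(ℝ, E) (extChartAt I x) ((extChartAt I x).symm (k w))).inverse
          (mfderiv I 𝓘(ℝ, E) (extChartAt I x) ((extChartAt I x).symm (k w)) u) = u :=
      (hinv.inverse_apply_eq).2 rfl
    replace h4 := h4 (mfderiv 𝓘(ℝ, F) I ((extChartAt I x).symm ∘ k) w v)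
    exact (congrArg (η ((extChartAt I x).symm (k w))) h4).symm.trans e2

end LocalLeaf

/-! ### The metric induced on an immersed manifold -/

section PullbackMetric

variable {E : Type*} [NormedAddCommGroup E] [NormedSpace ℝ E] [FiniteDimensional ℝ E]
  {H : Type*} [TopologicalSpace H] {I : ModelWithCorners ℝ E H}
  {M : Type*} [TopologicalSpace M] [ChartedSpace H M] [IsManifold I ∞ M]
  {E' : Type*} [NormedAddCommGroup E'] [NormedSpace ℝ E'] [FiniteDimensional ℝ E']
  {H' : Type*} [TopologicalSpace H'] {I' : ModelWithCorners ℝ E' H'}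
  {N : Type*} [TopologicalSpace N] [ChartedSpace H' N] [IsManifold I' ∞ N]

theorem exists_leftInverse_mfderiv {f : N → M} {p : N}
    (hf : Function.Injective (mfderiv I' I f p)) :
    ∃ L : TangentSpace I (f p) →L[ℝ] TangentSpace I' p, ∀ u, L (mfderiv I' I f p u) = u := by
  obtain ⟨L, hL⟩ := LinearMap.exists_leftInverse_of_injective
    (V := TangentSpace I' p) (V' := TangentSpace I (f p)) (mfderiv I' I f p).toLinearMap
    (LinearMap.ker_eq_bot.2 hf)
  have : FiniteDimensional ℝ (TangentSpace I (f p)) := inferInstanceAs (FiniteDimensional ℝ E)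
  have : T2Space (TangentSpace I (f p)) := inferInstanceAs (T2Space E)
  exact ⟨LinearMap.toContinuousLinearMap (E := TangentSpace I (f p)) (F' := TangentSpace I' p) L,
    fun u ↦ LinearMap.congr_fun hL u⟩

variable [RiemannianBundle (fun x : M ↦ TangentSpace I x)]
  [IsContMDiffRiemannianBundle I ∞ E (fun x : M ↦ TangentSpace I x)]

/-- An immersion pulls a Riemannian metric back to a Riemannian metric. -/
theorem exists_pullback_metric [T2Space N] {f : N → M} (hf : ContMDiff I' I ∞ f)
    (hinj : ∀ p, Function.Injective (mfderiv I' I f p)) :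
    ∃ g : ContMDiffRiemannianMetric I' ∞ E' (fun p : N ↦ TangentSpace I' p), ∀ p u v,
      g.inner p u v = inner ℝ (mfderiv I' I f p u) (mfderiv I' I f p v) := by
  obtain ⟨G, -, hG⟩ := IsContMDiffRiemannianBundle.exists_contMDiff (IB := I) (n := ∞) (F := E)
    (E := fun x : M ↦ TangentSpace I x)
  let B (p : N) : TangentSpace I' p →L[ℝ] TangentSpace I' p →L[ℝ] ℝ :=
    (ContinuousLinearMap.precomp ℝ (mfderiv I' I f p)).comp ((G (f p)).comp (mfderiv I' I f p))
  have hB (p : N) (u v : TangentSpace I' p) :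
      B p u v = inner ℝ (mfderiv I' I f p u) (mfderiv I' I f p v) := (hG _ _ _).symm
  refine ⟨⟨B, fun p u v ↦ ?_, fun p u hu ↦ ?_, fun p ↦ ?_, ?_⟩, hB⟩
  · rw [hB, hB, real_inner_comm]
  · rw [hB]
    exact real_inner_self_pos.2 fun h ↦ hu (hinj p (h.trans (map_zero _).symm))
  -- a continuous left inverse `L` of the differential bounds the unit ball
  · obtain ⟨L, hL⟩ := exists_leftInverse_mfderiv (hinj p)
    have h : Bornology.IsVonNBounded ℝ (L '' Metric.ball 0 1) :=
      (NormedSpace.isVonNBounded_ball ℝ (TangentSpace I (f p)) 1).image L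
    refine h.subset ?_
    intro u hu
    refine ⟨mfderiv I' I f p u, ?_, hL u⟩
    rw [Set.mem_ofPred_eq, hB, real_inner_self_eq_norm_sq] at hu
    rw [mem_ball_zero_iff]
    exact (sq_lt_one_iff₀ (norm_nonneg _)).1 hu
  · refine contMDiff_hom_of_apply (E' := E' →L[ℝ] ℝ)
      (V := fun p : N ↦ TangentSpace I' p →L[ℝ] Bundle.Trivial N ℝ p) fun X hX ↦ ?_
    refine contMDiff_hom_of_apply (E' := ℝ) (V := Bundle.Trivial N ℝ) fun Y hY ↦ ?_
    intro p
    refine contMDiffAt_totalSpace.2 ⟨contMDiffAt_id, ?_⟩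
    have h := ContMDiffAt.inner_bundle (E := fun x : M ↦ TangentSpace I x)
      (contMDiffAt_mfderiv_apply (hf p) (hX p)) (contMDiffAt_mfderiv_apply (hf p) (hY p))
    exact h.congr_of_eventuallyEq (Filter.Eventually.of_forall fun q ↦ hB q _ _)

end PullbackMetric

/-! ### Existence of integral manifolds -/

section Existence

variable {n : ℕ} {M : Type u} [TopologicalSpace M] [T2Space M]
  [ChartedSpace (EuclideanSpace ℝ (Fin (2 * n + 1))) M] [IsManifold (𝓡 (2 * n + 1)) ∞ M]
  [RiemannianBundle (fun x : M ↦ TangentSpace (𝓡 (2 * n + 1)) x)]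
  [IsContMDiffRiemannianBundle (𝓡 (2 * n + 1)) ∞ (EuclideanSpace ℝ (Fin (2 * n + 1)))
    (fun x : M ↦ TangentSpace (𝓡 (2 * n + 1)) x)]
  {S : ApcpcR n M}

theorem ApcpcR.finrank_ker_eta (S : ApcpcR n M) (x : M) :
    Module.finrank ℝ (LinearMap.ker (S.η x).toLinearMap) = 2 * n := by
  have h1 := LinearMap.finrank_range_add_finrank_ker (S.η x).toLinearMap
  have h2 : LinearMap.range (S.η x).toLinearMap = ⊤ :=
    LinearMap.range_eq_top.2 fun t ↦ ⟨t • S.ξ x, by simp [S.eta_xi]⟩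
  have h3 : Module.finrank ℝ (TangentSpace (𝓡 (2 * n + 1)) x) = 2 * n + 1 :=
    finrank_euclideanSpace_fin
  rw [h2, finrank_top, Module.finrank_self, h3] at h1
  omega

/-- An injective immersion tangent to `ker η` underlies an integral manifold. -/
theorem exists_integralManifold_of_immersion (S : ApcpcR n M) {N : Type u} [TopologicalSpace N]
    [T2Space N] [SecondCountableTopology N] [ChartedSpace (EuclideanSpace ℝ (Fin (2 * n))) N]
    [IsManifold (𝓡 (2 * n)) ∞ N] {f : N → M} (hf : ContMDiff (𝓡 (2 * n)) (𝓡 (2 * n + 1)) ∞ f)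
    (hfi : Function.Injective f)
    (hinj : ∀ p, Function.Injective (mfderiv (𝓡 (2 * n)) (𝓡 (2 * n + 1)) f p))
    (hη : ∀ p u, S.η (f p) (mfderiv (𝓡 (2 * n)) (𝓡 (2 * n + 1)) f p u) = 0) :
    ∃ N' : IntegralManifold S, Set.range N'.incl = Set.range f := by
  obtain ⟨g, hg⟩ := exists_pullback_metric hf hinj
  choose L hL using fun p ↦ exists_leftInverse_mfderiv (hinj p)
  have hrange (p : N) : LinearMap.range (mfderiv (𝓡 (2 * n)) (𝓡 (2 * n + 1)) f p).toLinearMap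
      = LinearMap.ker (S.η (f p)).toLinearMap := by
    have : FiniteDimensional ℝ (TangentSpace (𝓡 (2 * n + 1)) (f p)) :=
      inferInstanceAs (FiniteDimensional ℝ (EuclideanSpace ℝ (Fin (2 * n + 1))))
    refine Submodule.eq_of_le_of_finrank_eq ?_ ?_
    · rintro _ ⟨u, rfl⟩
      exact hη p u
    · rw [S.finrank_ker_eta, LinearMap.finrank_range_of_inj (hinj p)]
      exact finrank_euclideanSpace_fin
  have hLr (p : N) (w : TangentSpace (𝓡 (2 * n + 1)) (f p)) (hw : S.η (f p) w = 0) :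
      mfderiv (𝓡 (2 * n)) (𝓡 (2 * n + 1)) f p (L p w) = w := by
    obtain ⟨u, hu⟩ : w ∈ LinearMap.range (mfderiv (𝓡 (2 * n)) (𝓡 (2 * n + 1)) f p).toLinearMap := by
      rw [hrange]; exact hw
    have hu' : mfderiv (𝓡 (2 * n)) (𝓡 (2 * n + 1)) f p u = w := hu
    rw [← hu', hL]
  let : RiemannianBundle (fun p : N ↦ TangentSpace (𝓡 (2 * n)) p) := ⟨g.toRiemannianMetric⟩
  exact ⟨{
    carrier := N
    incl := f
    contMDiff_incl := hf
    injective_incl := hfi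
    range_mfderiv := hrange
    inner_eq := hg
    P := fun p ↦ (L p).comp ((S.φ (f p)).comp (mfderiv (𝓡 (2 * n)) (𝓡 (2 * n + 1)) f p))
    mfderiv_P := fun p u ↦ hLr p _ (S.eta_phi _ _) }, rfl⟩

/-- Through each point there is an integral manifold of `ker η`, as `η` is closed. -/
theorem exists_integralManifold (hS : S.IsParaSasakiLike) (x : M) :
    ∃ N : IntegralManifold S, x ∈ Set.range N.incl := by
  have hx : S.η x ≠ 0 := fun h ↦ by simpa [h] using S.eta_xi x
  obtain ⟨U, w₀, j, ρ, hU, hw₀, hj₀, hj, hjU⟩ := exists_parametrization_of_closed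
    (F := EuclideanSpace ℝ (Fin (2 * n))) (by simp) S.smooth_eta
    (fun X Y hX hY p ↦ hS.eta_closed hX hY p) hx
  -- `U` lies in `Type`, hence the lift to the universe of `M`
  let e : ULift.{u} U → EuclideanSpace ℝ (Fin (2 * n)) := fun p ↦ p.down.val
  have he : Topology.IsOpenEmbedding e :=
    hU.isOpenEmbedding_subtypeVal.comp Homeomorph.ulift.isOpenEmbedding
  have : Nonempty (ULift.{u} U) := ⟨⟨⟨w₀, hw₀⟩⟩⟩
  let := he.singletonChartedSpace
  have : IsManifold (𝓡 (2 * n)) ∞ (ULift.{u} U) := he.isManifold_singleton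
  have : T2Space (ULift.{u} U) := he.isEmbedding.t2Space
  have : SecondCountableTopology (ULift.{u} U) := he.isEmbedding.secondCountableTopology
  have hes : ContMDiff (𝓡 (2 * n)) (𝓡 (2 * n)) ∞ e := contMDiff_isOpenEmbedding he
  have hei (p : ULift.{u} U) : Function.Injective (mfderiv (𝓡 (2 * n)) (𝓡 (2 * n)) e p) :=
    (isInvertible_mfderiv_extChartAt (mem_extChartAt_source (I := 𝓡 (2 * n)) p)).injective
  have hjd (p : ULift.{u} U) :
      MDifferentiableAt (𝓡 (2 * n)) (𝓡 (2 * n + 1)) j (e p) :=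
    (hj.contMDiffAt (hU.mem_nhds p.down.2)).mdifferentiableAt (by simp)
  have hf : ContMDiff (𝓡 (2 * n)) (𝓡 (2 * n + 1)) ∞ (j ∘ e) :=
    hj.comp_contMDiff hes fun p ↦ p.down.2
  have hρ : ρ ∘ (j ∘ e) = e := funext fun p ↦ (hjU _ p.down.2).1
  have hfi : Function.Injective (j ∘ e) := by
    refine Function.Injective.of_comp (f := ρ) ?_
    rw [hρ]
    exact he.injective
  have hinj (p : ULift.{u} U) :
      Function.Injective (mfderiv (𝓡 (2 * n)) (𝓡 (2 * n + 1)) (j ∘ e) p) := by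
    have h := mfderiv_comp p ((hjU _ p.down.2).2.1.mdifferentiableAt (by simp))
      ((hf p).mdifferentiableAt (by simp))
    rw [hρ] at h
    have h2 := hei p
    rw [h] at h2
    exact Function.Injective.of_comp h2
  obtain ⟨N, hN⟩ := exists_integralManifold_of_immersion S hf hfi hinj fun p u ↦ by
    rw [mfderiv_comp p (hjd p) ((hes p).mdifferentiableAt (by simp))]
    exact (hjU _ p.down.2).2.2 _
  exact ⟨N, hN ▸ ⟨⟨⟨w₀, hw₀⟩⟩, hj₀⟩⟩

end Existence

end ParaSasaki

theorem proposition3p2 {n : ℕ} (hn : 1 ≤ n) {M : Type u} [TopologicalSpace M] [T2Space M]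
    [SecondCountableTopology M]
    [ChartedSpace (EuclideanSpace ℝ (Fin (2 * n + 1))) M] [IsManifold (𝓡 (2 * n + 1)) ∞ M]
    [RiemannianBundle (fun x : M ↦ TangentSpace (𝓡 (2 * n + 1)) x)]
    [IsContMDiffRiemannianBundle (𝓡 (2 * n + 1)) ∞ (EuclideanSpace ℝ (Fin (2 * n + 1)))
      (fun x : M ↦ TangentSpace (𝓡 (2 * n + 1)) x)]
    (S : ParaSasaki.ApcpcR n M) (hS : S.IsParaSasakiLike) :
    -- the underlying local manifolds exist and are phpcR manifolds
    (∀ x : M, ∃ N : ParaSasaki.IntegralManifold S, x ∈ Set.range N.incl) ∧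
    (∀ N : ParaSasaki.IntegralManifold S, ParaSasaki.IsPhpcR N.P) ∧
    -- the Einstein condition, tested on all integral manifolds
    (ParaSasaki.IsEinstein (𝓡 (2 * n + 1)) M ↔
      ∀ N : ParaSasaki.IntegralManifold S,
        ParaSasaki.RicciEq (𝓡 (2 * n)) N.carrier (-2 * (n : ℝ))) ∧
    -- the Einstein condition, tested on one integral manifold through each point
    (ParaSasaki.IsEinstein (𝓡 (2 * n + 1)) M ↔
      ∀ x : M, ∃ N : ParaSasaki.IntegralManifold S, x ∈ Set.range N.incl ∧
        ParaSasaki.RicciEq (𝓡 (2 * n)) N.carrier (-2 * (n : ℝ))) ∧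
    -- `Ric^h = -2n h` means: Einstein with scalar curvature `-4n²`
    (∀ N : ParaSasaki.IntegralManifold S,
      ParaSasaki.RicciEq (𝓡 (2 * n)) N.carrier (-2 * (n : ℝ)) ↔
        ParaSasaki.IsEinstein (𝓡 (2 * n)) N.carrier ∧
          ∀ p : N.carrier, ParaSasaki.scalarCurvature (𝓡 (2 * n)) p = -4 * (n : ℝ) ^ 2) := by
  have hex := ParaSasaki.exists_integralManifold hS
  refine ⟨hex, fun N ↦ N.isPhpcR hS, ?_, ?_, fun N ↦ ?_⟩
  · refine ⟨fun h N ↦ N.ricciEq_of_isEinstein hS h,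
      fun h ↦ ParaSasaki.IntegralManifold.isEinstein_of_ricciEq hS fun x ↦ ?_⟩
    obtain ⟨N, hN⟩ := hex x
    exact ⟨N, hN, h N⟩
  · refine ⟨fun h x ↦ ?_, ParaSasaki.IntegralManifold.isEinstein_of_ricciEq hS⟩
    obtain ⟨N, hN⟩ := hex x
    exact ⟨N, hN, N.ricciEq_of_isEinstein hS h⟩
  · rw [ParaSasaki.ricciEq_iff_isEinstein_and_scalarCurvature (by omega : 2 * n ≠ 0)]
    have e : ((2 * n : ℕ) : ℝ) * (-2 * (n : ℝ)) = -4 * (n : ℝ) ^ 2 := by push_cast; ring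
    rw [e]
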